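/- **Theorem (the canonical model of FOLPb is fully explanatory).** *Language.* Let $x_0,x_1,\dots$ be the basic variables and $V$ a countably infinite set of further individual variables, the witness variables, which are never quantified and never used as subscripts of $\mathsf{gen}$. Justification terms are given by $t ::= p_i \mid c_i \mid (t\cdot t)\mid (t+t)\mid\, !t\mid \mathsf b(t)\mid \mathsf{gen}_{x}(t)$ ($x$ a basic variable) and formulas by $\varphi ::= P(v_1,\dots,v_n)\mid\bot\mid(\varphi\to\varphi)\mid\forall x\,\varphi\mid t{:}_X\varphi$, with countably many predicate symbols $P$ of each arity, individual variables $v_i$, $x$ a basic variable and $X$ a finite set of individual variables; $\neg,\vee,\wedge$ are defined from $\to,\bot$. Free variables are as usual, with $fv(t{:}_X\varphi)=X$: an occurrence in $\varphi$ of a variable outside $X$ is not free in $t{:}_X\varphi$. A substitution replaces free occurrences; it is capture-free if no new variable comes under a quantifier binding it and, in each $t{:}_X\varphi$, no new member of the subscript equals a variable of $fv(\varphi)\setminus X$. A formula is *basic* if it contains no witness variable, a *Henkin formula* if witness variables occur in it only free (in each subformula $t{:}_X\varphi$ all witness variables of $\varphi$ lie in $X$), and *closed* if it has no free basic variables. *Axioms*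 (where $Xy$ means $X\cup\{y\}$ with $y\notin X$): A1: $\varphi\to(\psi\to\varphi)$; $(\varphi\to(\psi\to\chi))\to((\varphi\to\psi)\to(\varphi\to\chi))$; $\neg\neg\varphi\to\varphi$; $\forall x\varphi\to\varphi(y/x)$ if this substitution is capture-free; $\forall x(\varphi\to\psi)\to(\varphi\to\forall x\psi)$ if $x\notin fv(\varphi)$. A2: $t{:}_{Xy}\varphi\to t{:}_X\varphi$ if $y\notin fv(\varphi)$. A3: $t{:}_X\varphi\to t{:}_{Xy}\varphi$. B1: $t{:}_X\varphi\to\varphi$. B2: $t{:}_X(\varphi\to\psi)\to(s{:}_X\varphi\to [t\cdot s]{:}_X\psi)$. B3: $t{:}_X\varphi\to[t+s]{:}_X\varphi$ and $s{:}_X\varphi\to[t+s]{:}_X\varphi$. B4: $t{:}_X\varphi\to\,!t{:}_X\,t{:}_X\varphi$. B5: $t{:}_X\varphi\to\mathsf{gen}_x(t){:}_X\forall x\varphi$ if $x\notin X$. Bb: $\forall y\,t{:}_{Xy}\varphi\to\mathsf b(t){:}_X\forall y\varphi$. *Constant specifications.* Write $c{:}\psi$ for $c{:}_\emptyset\psi$.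 A *constant specification* $CS$ is a set of formulas $c{:}\psi$ with $c$ a constant $c_i$ and $\psi$ a basic axiom. It is *axiomatically appropriate* if every basic axiom $\psi$ has some $c$ with $c{:}\psi\in CS$, and *variant closed* if, whenever the basic axioms $\varphi,\psi$ differ only by a one-to-one capture-free renaming of free variables, $c{:}\varphi\in CS$ iff $c{:}\psi\in CS$. $CS(V)$ is the set of all $c{:}\psi$ such that the Henkin formula $\psi$ arises from some $\varphi$ with $c{:}\varphi\in CS$ by replacing some of the free basic variables of $\varphi$ by distinct witness variables. *Derivations.* $\Gamma\vdash\varphi$ means that $\varphi$ is derivable from $\Gamma$, from the Henkin formulas that are axioms and from $CS(V)$, by modus ponens and generalization ($\varphi\Rightarrow\forall x\varphi$), the latter never applied to a variable free in a hypothesis on which its premise depends. $\Gamma$ is consistent if $\Gamma\not\vdash\bot$. A set of Henkin formulas is maximally consistent if it is consistent and no proper extension of it by Henkin formulas is. *Instantiation.* A disjunctive template is a propositional modal formula built from letters with $\vee$ and $\Box$ only, in which no letter occurs twice. Its instantiation set, for Henkin formulas $\varphi_i$ assigned to its letters $\mathbf p_i$, is defined by $[\![\mathbf p_i]\!]=\{\varphi_i\}$,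 $[\![G\vee H]\!]=\{\psi\vee\theta:\psi\in[\![G]\!],\theta\in[\![H]\!]\}$, and $[\![\Box G]\!]=\{t{:}_X\psi:\psi\in[\![G]\!],\ t\text{ a term},\ X\text{ the set of witness variables in }\psi\}$; $[\![\neg F]\!]=\{\neg\psi:\psi\in[\![F]\!]\}$. $\Gamma$ *admits instantiation* if for every disjunctive template $F(\vec{\mathbf p},\mathbf q)$, Henkin formulas $\vec\varphi$ and Henkin formula $\forall x\varphi(x)$ such that $\Gamma\cup[\![\neg F(\vec\varphi,\forall x\varphi(x))]\!]$ is consistent, there is $a\in V$ such that $\Gamma\cup[\![\neg F(\vec\varphi,\varphi(a))]\!]$ is consistent. *Canonical model.* The worlds are the maximally consistent sets of Henkin formulas that admit instantiation, and the domain is $V$. $\Gamma\mathcal R\Delta$ iff $\Delta$ contains every $\forall\vec y\,\varphi$ such that $\varphi$ is a Henkin formula, $t{:}_X\varphi\in\Gamma$ for some term $t$, $X$ is the set of witness variables in $\varphi$, and $\vec y$ lists the free basic variables of $\varphi$. $\mathcal I(P,\Gamma)=\{\vec a : P(\vec a)\in\Gamma\}$. $\Gamma\in\mathcal E(t,\varphi)$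 iff $\varphi$ is a Henkin formula and $t{:}_X\varphi\in\Gamma$, where $X$ is the set of witness variables in $\varphi$. Truth of closed Henkin formulas at a world is defined by: $\Gamma\Vdash P(\vec a)$ iff $\vec a\in\mathcal I(P,\Gamma)$; $\Gamma\not\Vdash\bot$; $\Gamma\Vdash\varphi\to\psi$ iff $\Gamma\not\Vdash\varphi$ or $\Gamma\Vdash\psi$; $\Gamma\Vdash\forall x\varphi(x)$ iff $\Gamma\Vdash\varphi(a)$ for all $a\in V$; $\Gamma\Vdash t{:}_X\varphi$ iff $\Gamma\in\mathcal E(t,\varphi)$ and, for all $\Delta$ with $\Gamma\mathcal R\Delta$, every result of replacing the free basic variables of $\varphi$ by members of $V$ is true at $\Delta$. *Claim.* Let $CS$ be a variant closed and axiomatically appropriate constant specification. Then the canonical model using $CS$ is fully explanatory: for every closed Henkin formula $\varphi$ and every world $\Gamma$, if $\Delta\Vdash\varphi$ for every world $\Delta$ with $\Gamma\mathcal R\Delta$, then there is a justification term $t$ with $\Gamma\Vdash t{:}_X\varphi$, where $X$ is the set of witness variables occurring in $\varphi$. -/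

import Mathlib

namespace FOLPb

universe u v

/-- Justification terms: variables `p_i`, constants `c_i`, application, sum, `!`, `b` and
`gen_x` for every basic individual variable `x` (basic individual variables are numbers). -/
inductive JTerm : Type where
  | jvar (i : ℕ) : JTerm
  | const (i : ℕ) : JTerm
  | app (t s : JTerm) : JTerm
  | plus (t s : JTerm) : JTerm
  | bang (t : JTerm) : JTerm
  | barcan (t : JTerm) : JTerm
  | gen (x : ℕ) (t : JTerm) : JTerm

/-- Individual symbols over `D`: `Sum.inl n` is the basic variable `x_n`, and `Sum.inr d` is the
domain constant (in the Henkin language: the witness variable) `d`. -/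
abbrev Var (D : Type u) : Type u := ℕ ⊕ D

/-- First-order justification formulas with individual symbols from `Var D`.  Only basic variables
are quantified.  `pred n P args` is the atomic formula built with the `P`-th `n`-ary predicate
symbol; `box t X φ` is `t :_X φ`. -/
inductive Fml (D : Type u) : Type u where
  | pred (n : ℕ) (P : ℕ) (args : Fin n → Var D) : Fml D
  | bot : Fml D
  | imp (φ ψ : Fml D) : Fml D
  | all (x : ℕ) (φ : Fml D) : Fml D
  | box (t : JTerm) (X : Finset (Var D)) (φ : Fml D) : Fml D

namespace Fml

variable {D : Type u}

/-- Negation `φ → ⊥`. -/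
def neg (φ : Fml D) : Fml D := imp φ bot

/-- Disjunction `¬φ → ψ`. -/
def or (φ ψ : Fml D) : Fml D := imp (neg φ) ψ

/-- Conjunction `¬(φ → ¬ψ)`. -/
def and (φ ψ : Fml D) : Fml D := neg (imp φ (neg ψ))

/-- The degree of a formula: the number of its connectives, quantifiers and modal operators. -/
def degree : Fml D → ℕ
  | pred _ _ _ => 0
  | bot => 0
  | imp φ ψ => degree φ + degree ψ + 1
  | all _ φ => degree φ + 1
  | box _ _ φ => degree φ + 1

variable [DecidableEq D]

/-- Free individual symbols; `fv (t :_X φ) = X`. -/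
def fv : Fml D → Finset (Var D)
  | pred _ _ args => Finset.univ.image args
  | bot => ∅
  | imp φ ψ => fv φ ∪ fv ψ
  | all x φ => (fv φ).erase (Sum.inl x)
  | box _ X _ => X

/-- The domain constants (witness variables) that appear in a formula. -/
def consts : Fml D → Finset (Var D)
  | pred _ _ args => (Finset.univ.image args).filter (fun v => v.isRight)
  | bot => ∅
  | imp φ ψ => consts φ ∪ consts ψ
  | all _ φ => consts φ
  | box _ X φ => X.filter (fun v => v.isRight) ∪ consts φ

/-- A formula of the basic language: no domain constant appears in it. -/
def IsBasic (φ : Fml D) : Prop := consts φ = ∅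

/-- `D`-formulas: every occurrence of a domain constant is free, that is, in each subformula
`t :_X φ` the constants of `φ` belong to `X`.  For `D = V` these are the Henkin formulas. -/
def IsDFormula : Fml D → Prop
  | pred _ _ _ => True
  | bot => True
  | imp φ ψ => IsDFormula φ ∧ IsDFormula ψ
  | all _ φ => IsDFormula φ
  | box _ X φ => consts φ ⊆ X ∧ IsDFormula φ

/-- Closed formulas: no basic variable is free. -/
def IsClosed (φ : Fml D) : Prop := ∀ x : ℕ, Sum.inl x ∉ fv φ

/-- Simultaneous replacement of the free occurrences of each `v` by `σ v`. -/
def subst : (Var D → Var D) → Fml D → Fml D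
  | σ, pred n P args => pred n P (fun i => σ (args i))
  | _, bot => bot
  | σ, imp φ ψ => imp (subst σ φ) (subst σ ψ)
  | σ, all x φ => all x (subst (Function.update σ (Sum.inl x) (Sum.inl x)) φ)
  | σ, box t X φ => box t (X.image σ) (subst (fun v => if v ∈ X then σ v else v) φ)

/-- The replacement `σ` captures nothing: no new symbol comes under a quantifier that binds it,
and in `t :_X φ` no new member of the subscript coincides with a symbol that is free in `φ` but
not in `X`. -/
def FreeFor : (Var D → Var D) → Fml D → Prop
  | _, pred _ _ _ => True
  | _, bot => True
  | σ, imp φ ψ => FreeFor σ φ ∧ FreeFor σ ψ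
  | σ, all x φ =>
      (∀ z ∈ fv (all x φ), σ z ≠ Sum.inl x) ∧
        FreeFor (Function.update σ (Sum.inl x) (Sum.inl x)) φ
  | σ, box _ X φ =>
      (∀ z ∈ X, ∀ y ∈ fv φ, y ∉ X → σ z ≠ y) ∧
        FreeFor (fun v => if v ∈ X then σ v else v) φ

/-- The map of symbols that sends the basic variable `x` to `y` and fixes everything else. -/
def single (x : ℕ) (y : Var D) : Var D → Var D := Function.update id (Sum.inl x) y

/-- `φ(y/x)`. -/
def subst1 (x : ℕ) (y : Var D) (φ : Fml D) : Fml D := subst (single x y) φ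

/-- `φ(a⃗)`: every free basic variable `x` is replaced by the domain constant `a x`. -/
def instAll (a : ℕ → D) (φ : Fml D) : Fml D :=
  subst (Sum.elim (fun x => Sum.inr (a x)) Sum.inr) φ

/-- `∀ y₁ … ∀ yₙ φ`. -/
def alls (ys : List ℕ) (φ : Fml D) : Fml D := ys.foldr all φ

theorem degree_subst (φ : Fml D) : ∀ σ : Var D → Var D, degree (subst σ φ) = degree φ := by
  induction φ with
  | pred n P args => intro σ; rfl
  | bot => intro σ; rfl
  | imp φ ψ ih1 ih2 => intro σ; simp [subst, degree, ih1, ih2]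
  | all x φ ih => intro σ; simp [subst, degree, ih]
  | box t X φ ih => intro σ; simp [subst, degree, ih]

/-- Two formulas are variable variants: one is turned into the other by a one-to-one, capture-free
renaming of its free individual symbols (the inverse renaming then leads back). -/
def VarVariant (φ ψ : Fml D) : Prop :=
  ∃ σ : Var D → Var D, Set.InjOn σ (fv φ : Set (Var D)) ∧ FreeFor σ φ ∧ ψ = subst σ φ

end Fml

open Fml

section ProofSystem

variable {D : Type u} [DecidableEq D]

/-- The axiom schemes of `FOLPb₀`.  The first five are a standard axiomatization of classical
first-order logic (with modus ponens and generalization as rules); `insert y X` with `y ∉ X`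
is written `Xy` in the usual notation. -/
inductive IsAxiom : Fml D → Prop
  | a1_k (φ ψ : Fml D) : IsAxiom (imp φ (imp ψ φ))
  | a1_s (φ ψ χ : Fml D) :
      IsAxiom (imp (imp φ (imp ψ χ)) (imp (imp φ ψ) (imp φ χ)))
  | a1_dne (φ : Fml D) : IsAxiom (imp (neg (neg φ)) φ)
  | a1_inst (x : ℕ) (y : Var D) (φ : Fml D) (h : FreeFor (single x y) φ) :
      IsAxiom (imp (all x φ) (subst1 x y φ))
  | a1_all (x : ℕ) (φ ψ : Fml D) (h : Sum.inl x ∉ fv φ) :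
      IsAxiom (imp (all x (imp φ ψ)) (imp φ (all x ψ)))
  | a2 (t : JTerm) (X : Finset (Var D)) (y : Var D) (φ : Fml D) (hX : y ∉ X) (hy : y ∉ fv φ) :
      IsAxiom (imp (box t (insert y X) φ) (box t X φ))
  | a3 (t : JTerm) (X : Finset (Var D)) (y : Var D) (φ : Fml D) (hX : y ∉ X) :
      IsAxiom (imp (box t X φ) (box t (insert y X) φ))
  | b1 (t : JTerm) (X : Finset (Var D)) (φ : Fml D) : IsAxiom (imp (box t X φ) φ)
  | b2 (t s : JTerm) (X : Finset (Var D)) (φ ψ : Fml D) :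
      IsAxiom (imp (box t X (imp φ ψ)) (imp (box s X φ) (box (JTerm.app t s) X ψ)))
  | b3_left (t s : JTerm) (X : Finset (Var D)) (φ : Fml D) :
      IsAxiom (imp (box t X φ) (box (JTerm.plus t s) X φ))
  | b3_right (t s : JTerm) (X : Finset (Var D)) (φ : Fml D) :
      IsAxiom (imp (box s X φ) (box (JTerm.plus t s) X φ))
  | b4 (t : JTerm) (X : Finset (Var D)) (φ : Fml D) :
      IsAxiom (imp (box t X φ) (box (JTerm.bang t) X (box t X φ)))
  | b5 (t : JTerm) (X : Finset (Var D)) (x : ℕ) (φ : Fml D) (hx : Sum.inl x ∉ X) :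
      IsAxiom (imp (box t X φ) (box (JTerm.gen x t) X (all x φ)))
  | bb (t : JTerm) (X : Finset (Var D)) (y : ℕ) (φ : Fml D) (hy : Sum.inl y ∉ X) :
      IsAxiom (imp (all y (box t (insert (Sum.inl y) X) φ)) (box (JTerm.barcan t) X (all y φ)))

/-- `Derives A Γ φ`: `φ` is derivable from the hypotheses `Γ` in the system whose axioms are the
`D`-formulas of the form of an axiom scheme and the members of `A`.  Generalization is never applied
to a variable that is free in a hypothesis on which the premise depends. -/
inductive Derives (A : Set (Fml D)) : Set (Fml D) → Fml D → Prop
  | ax {Γ : Set (Fml D)} {φ : Fml D} (h : IsAxiom φ) (hD : IsDFormula φ) : Derives A Γ φ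
  | cs {Γ : Set (Fml D)} {φ : Fml D} (h : φ ∈ A) : Derives A Γ φ
  | hyp {Γ : Set (Fml D)} {φ : Fml D} (h : φ ∈ Γ) : Derives A Γ φ
  | mp {Γ : Set (Fml D)} {φ ψ : Fml D} (h1 : Derives A Γ (imp φ ψ)) (h2 : Derives A Γ φ) :
      Derives A Γ ψ
  | gen {Γ : Set (Fml D)} {φ : Fml D} (x : ℕ) (hx : ∀ ψ ∈ Γ, Sum.inl x ∉ fv ψ)
      (h : Derives A Γ φ) : Derives A Γ (all x φ)
  | weaken {Δ Γ : Set (Fml D)} {φ : Fml D} (hs : Δ ⊆ Γ) (h : Derives A Δ φ) : Derives A Γ φ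

/-- `A`-consistency of a set of formulas. -/
def Consistent (A Γ : Set (Fml D)) : Prop := ¬ Derives A Γ bot

/-- Maximal `A`-consistency among the sets of `D`-formulas. -/
def MaxConsistent (A Γ : Set (Fml D)) : Prop :=
  (∀ φ ∈ Γ, IsDFormula φ) ∧ Consistent A Γ ∧
    ∀ Δ : Set (Fml D), (∀ φ ∈ Δ, IsDFormula φ) → Γ ⊆ Δ → Consistent A Δ → Δ = Γ

/-- A constant specification for the basic language: a set of formulas `c : ψ` with `c` a constant
and `ψ` an axiom of the basic language. -/
def IsConstantSpecification (CS : Set (Fml D)) : Prop :=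
  ∀ χ ∈ CS, ∃ (i : ℕ) (ψ : Fml D), IsAxiom ψ ∧ IsBasic ψ ∧ χ = box (JTerm.const i) ∅ ψ

/-- Every axiom of the basic language has a constant. -/
def AxiomaticallyAppropriate (CS : Set (Fml D)) : Prop :=
  ∀ ψ : Fml D, IsAxiom ψ → IsBasic ψ → ∃ i : ℕ, box (JTerm.const i) ∅ ψ ∈ CS

/-- Axioms of the basic language that are variable variants have the same constants.  Only axioms
are compared, since a variant of an axiom need not be an axiom: `t :_∅ P(y) → t :_{y} P(y)` is one,
its variant `t :_∅ P(y) → t :_{z} P(z)` is not, so no constant can be assigned to the latter. -/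
def VariantClosed (CS : Set (Fml D)) : Prop :=
  ∀ (i : ℕ) (φ ψ : Fml D), IsAxiom φ → IsBasic φ → IsAxiom ψ → IsBasic ψ → VarVariant φ ψ →
    (box (JTerm.const i) ∅ φ ∈ CS ↔ box (JTerm.const i) ∅ ψ ∈ CS)

/-- The extension `CS(V)` of `CS` to the Henkin language: all `c : ψ` such that, for some
`c : φ` in `CS`, the Henkin formula `ψ` results from `φ` by replacing some free basic variables
by distinct witness variables. -/
def extendCS (CS : Set (Fml D)) : Set (Fml D) :=
  {χ | ∃ (i : ℕ) (φ : Fml D) (σ : Var D → Var D),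
    box (JTerm.const i) ∅ φ ∈ CS ∧
    (∀ v ∈ fv φ, σ v = v ∨ ∃ a : D, σ v = Sum.inr a) ∧
    Set.InjOn σ (fv φ : Set (Var D)) ∧
    IsDFormula (subst σ φ) ∧
    χ = box (JTerm.const i) ∅ (subst σ φ)}

end ProofSystem

/-- Propositional modal formulas in the letters `p_0, p_1, …`. -/
inductive Template : Type where
  | letter (i : ℕ) : Template
  | neg (F : Template) : Template
  | or (F G : Template) : Template
  | and (F G : Template) : Template
  | box (F : Template) : Template

namespace Template

/-- The list of occurrences of letters. -/
def letters : Template → List ℕ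
  | letter i => [i]
  | neg F => letters F
  | or F G => letters F ++ letters G
  | and F G => letters F ++ letters G
  | box F => letters F

/-- No letter occurs more than once. -/
def IsLinear (F : Template) : Prop := (letters F).Nodup

/-- The only boolean connective that occurs is disjunction. -/
def OnlyOr : Template → Prop
  | letter _ => True
  | neg _ => False
  | or F G => OnlyOr F ∧ OnlyOr G
  | and _ _ => False
  | box F => OnlyOr F

/-- Disjunctive templates. -/
def IsDisjunctive (F : Template) : Prop := IsLinear F ∧ OnlyOr F

variable {D : Type u} [DecidableEq D]

/-- The instantiation set of a template, where `f i` is the formula assigned to the letter `i`. -/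
def inst (f : ℕ → Fml D) : Template → Set (Fml D)
  | letter i => {f i}
  | neg F => {χ | ∃ ψ ∈ inst f F, χ = Fml.neg ψ}
  | or F G => {χ | ∃ ψ ∈ inst f F, ∃ θ ∈ inst f G, χ = Fml.or ψ θ}
  | and F G => {χ | ∃ ψ ∈ inst f F, ∃ θ ∈ inst f G, χ = Fml.and ψ θ}
  | box F => {χ | ∃ ψ ∈ inst f F, ∃ t : JTerm, χ = Fml.box t (Fml.consts ψ) ψ}

end Template

section Canonical

variable {D : Type u} [DecidableEq D]

/-- `Γ` admits instantiation (consistency is consistency with respect to `A`): for each disjunctive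
template `F(p⃗, q)`, formulas `φ⃗` for `p⃗` and each `∀ x φ`, if `Γ ∪ ⟦¬F(φ⃗, ∀ x φ)⟧` is consistent,
then so is `Γ ∪ ⟦¬F(φ⃗, φ(a))⟧` for some witness variable `a`. -/
def AdmitsInstantiation (A Γ : Set (Fml D)) : Prop :=
  ∀ (F : Template) (q : ℕ) (f : ℕ → Fml D) (x : ℕ) (φ : Fml D),
    F.IsDisjunctive → (∀ i, IsDFormula (f i)) → IsDFormula φ →
    Consistent A (Γ ∪ Template.inst (Function.update f q (all x φ)) (Template.neg F)) →
    ∃ a : D, Consistent A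
      (Γ ∪ Template.inst (Function.update f q (subst1 x (Sum.inr a) φ)) (Template.neg F))

/-- `Γ^#`: all `∀ y⃗ φ` such that `t :_X φ ∈ Γ` for some term `t`, where `X` is the set of witness
variables of `φ` and `y⃗` lists the free basic variables of `φ`. -/
def sharp (Γ : Set (Fml D)) : Set (Fml D) :=
  {χ | ∃ (t : JTerm) (φ : Fml D) (ys : List ℕ),
    IsDFormula φ ∧ box t (consts φ) φ ∈ Γ ∧
    ys.Nodup ∧ (∀ y : ℕ, y ∈ ys ↔ Sum.inl y ∈ fv φ) ∧ χ = alls ys φ}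

end Canonical

/-- The constituents of a Fitting model with set of worlds `W` and constant domain `D`:
accessibility relation, interpretation and evidence function. -/
structure FittingModel (W : Type u) (D : Type v) where
  R : W → W → Prop
  I : (n : ℕ) → (P : ℕ) → W → Set (Fin n → D)
  E : JTerm → Fml D → Set W

namespace FittingModel

variable {W : Type u} {D : Type v} [DecidableEq D]

/-- Truth of closed `D`-formulas at a world. -/
def Truth (M : FittingModel W D) (w : W) : Fml D → Prop
  | .pred n P args => ∃ a : Fin n → D, (∀ i, args i = Sum.inr (a i)) ∧ a ∈ M.I n P w
  | .bot => False
  | .imp φ ψ => Truth M w φ → Truth M w ψ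
  | .all x φ => ∀ a : D, Truth M w (subst1 x (Sum.inr a) φ)
  | .box t _ φ => w ∈ M.E t φ ∧ ∀ w', M.R w w' → ∀ a : ℕ → D, Truth M w' (instAll a φ)
termination_by φ => degree φ
decreasing_by
  all_goals simp only [degree, subst1, instAll, degree_subst]; omega

/-- Whenever a closed `D`-formula `φ` is true at all worlds accessible from `w`, some `t :_X φ` is
true at `w`, where `X` is the set of domain constants that appear in `φ`. -/
def FullyExplanatory (M : FittingModel W D) : Prop :=
  ∀ φ : Fml D, IsDFormula φ → IsClosed φ → ∀ w : W,
    (∀ v : W, M.R w v → M.Truth v φ) → ∃ t : JTerm, M.Truth w (box t (consts φ) φ)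

end FittingModel

/-- Worlds of the canonical model: the maximally `CS(V)`-consistent sets of Henkin formulas that
admit instantiation. -/
def CanonicalWorld {V : Type u} [DecidableEq V] (CS : Set (Fml V)) : Type u :=
  {Γ : Set (Fml V) // MaxConsistent (extendCS CS) Γ ∧ AdmitsInstantiation (extendCS CS) Γ}

/-- The canonical model of `FOLPb` using the constant specification `CS`. -/
def canonicalModel {V : Type u} [DecidableEq V] (CS : Set (Fml V)) :
    FittingModel (CanonicalWorld CS) V where
  R Γ Δ := sharp Γ.1 ⊆ Δ.1
  I n P Γ := {a | pred n P (fun i => Sum.inr (a i)) ∈ Γ.1}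
  E t φ := {Γ | IsDFormula φ ∧ box t (consts φ) φ ∈ Γ.1}

end FOLPb

namespace FOLPb

universe u

/-! ### Free symbols, constants and substitution -/

namespace Fml

variable {D : Type u} [DecidableEq D]

/-- All symbols of a formula, free or bound. -/
def vars : Fml D → Finset (Var D)
  | pred _ _ args => Finset.univ.image args
  | bot => ∅
  | imp φ ψ => vars φ ∪ vars ψ
  | all x φ => insert (Sum.inl x) (vars φ)
  | box _ X φ => X ∪ vars φ

theorem fv_subset_vars (φ : Fml D) : fv φ ⊆ vars φ := by
  induction φ with
  | pred n P args => simp [fv, vars]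
  | bot => simp [fv, vars]
  | imp φ ψ ih1 ih2 => exact Finset.union_subset_union ih1 ih2
  | all x φ ih =>
    exact ((Finset.erase_subset _ _).trans ih).trans (Finset.subset_insert _ _)
  | box t X φ ih => exact Finset.subset_union_left

theorem inr_mem_consts_of_mem_fv {φ : Fml D} {d : D} (h : Sum.inr d ∈ fv φ) :
    Sum.inr d ∈ consts φ := by
  induction φ with
  | pred n P args => simpa [fv, consts] using h
  | bot => simp [fv] at h
  | imp φ ψ ih1 ih2 =>
    simp only [fv, consts, Finset.mem_union] at h ⊢
    exact h.imp ih1 ih2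
  | all x φ ih => exact ih (Finset.mem_of_mem_erase h)
  | box t X φ ih => simp only [fv] at h; simp [consts, h]

theorem exists_inr_of_mem_consts {φ : Fml D} {v : Var D} (h : v ∈ consts φ) :
    ∃ d : D, v = Sum.inr d := by
  have : v.isRight := by
    induction φ with
    | pred n P args => exact (Finset.mem_filter.1 h).2
    | bot => simp [consts] at h
    | imp φ ψ ih1 ih2 => exact (Finset.mem_union.1 h).elim ih1 ih2
    | all x φ ih => exact ih h
    | box t X φ ih =>
      exact (Finset.mem_union.1 h).elim (fun h => (Finset.mem_filter.1 h).2) ih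
  exact (Sum.isRight_iff.1 this)

theorem inl_notMem_consts (φ : Fml D) (n : ℕ) : Sum.inl n ∉ consts φ := fun h => by
  obtain ⟨d, hd⟩ := exists_inr_of_mem_consts h
  cases hd

theorem IsBasic.isDFormula {φ : Fml D} (h : IsBasic φ) : IsDFormula φ := by
  unfold IsBasic at h
  induction φ with
  | pred n P args => trivial
  | bot => trivial
  | imp φ ψ ih1 ih2 =>
    rw [consts, Finset.union_eq_empty] at h
    exact ⟨ih1 h.1, ih2 h.2⟩
  | all x φ ih => exact ih h
  | box t X φ ih =>
    rw [consts, Finset.union_eq_empty] at h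
    exact ⟨by simp [h.2], ih h.2⟩

theorem consts_box_self (t : JTerm) (φ : Fml D) : consts (box t (consts φ) φ) = consts φ := by
  rw [consts, Finset.union_eq_right]
  exact Finset.filter_subset _ _

theorem isDFormula_box_self {φ : Fml D} (t : JTerm) (h : IsDFormula φ) :
    IsDFormula (box t (consts φ) φ) := ⟨Finset.Subset.refl _, h⟩

theorem subst_eq_self {φ : Fml D} :
    ∀ {σ : Var D → Var D}, (∀ v ∈ fv φ, σ v = v) → subst σ φ = φ := by
  induction φ with
  | pred n P args =>
    intro σ h
    simp only [subst]
    congr 1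
    funext i
    exact h _ (by simp [fv])
  | bot => intro σ h; rfl
  | imp φ ψ ih1 ih2 =>
    intro σ h
    simp only [fv, Finset.mem_union] at h
    rw [subst, ih1 fun v hv => h v (Or.inl hv), ih2 fun v hv => h v (Or.inr hv)]
  | all x φ ih =>
    intro σ h
    rw [subst, ih]
    intro v hv
    by_cases hx : v = Sum.inl x
    · simp [hx]
    · rw [Function.update_of_ne hx]
      exact h v (Finset.mem_erase.2 ⟨hx, hv⟩)
  | box t X φ ih =>
    intro σ h
    simp only [fv] at h
    rw [subst, ih]
    · congr 1
      rw [Finset.image_congr (g := id) (fun v hv => h v hv), Finset.image_id]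
    · intro v _
      split_ifs with hX
      · exact h v hX
      · rfl

/-- Nothing is assumed of `σ` elsewhere, because the maps in `extendCS` are controlled only on the
free symbols of the formula. -/
theorem mem_consts_subst {φ : Fml D} :
    ∀ {σ : Var D → Var D} {v : Var D} {d : D}, v ∈ fv φ → σ v = Sum.inr d →
      Sum.inr d ∈ consts (subst σ φ) := by
  induction φ with
  | pred n P args =>
    intro σ v d hv hd
    simp only [fv, Finset.mem_image, Finset.mem_univ, true_and] at hv
    obtain ⟨i, rfl⟩ := hv
    simp only [subst, consts, Finset.mem_filter, Finset.mem_image, Finset.mem_univ, true_and,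
      Sum.isRight_inr, and_true]
    exact ⟨i, hd⟩
  | bot => intro σ v d hv; simp [fv] at hv
  | imp φ ψ ih1 ih2 =>
    intro σ v d hv hd
    simp only [fv, Finset.mem_union] at hv
    simp only [subst, consts, Finset.mem_union]
    exact hv.imp (fun h => ih1 h hd) (fun h => ih2 h hd)
  | all x φ ih =>
    intro σ v d hv hd
    simp only [fv, Finset.mem_erase] at hv
    exact ih hv.2 (by rw [Function.update_of_ne hv.1, hd])
  | box t X φ ih =>
    intro σ v d hv hd
    simp only [fv] at hv
    simp only [subst, consts, Finset.mem_union, Finset.mem_filter, Finset.mem_image,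
      Sum.isRight_inr, and_true]
    exact Or.inl ⟨v, hv, hd⟩

/-! ### Substitution of domain constants for basic variables -/

/-- A symbol map that fixes the domain constants and sends every basic variable to itself or to a
domain constant. -/
def IsInstantiation (σ : Var D → Var D) : Prop :=
  (∀ d : D, σ (Sum.inr d) = Sum.inr d) ∧
    ∀ n : ℕ, σ (Sum.inl n) = Sum.inl n ∨ ∃ d : D, σ (Sum.inl n) = Sum.inr d

namespace IsInstantiation

theorem eq_self_or {D : Type u} {σ : Var D → Var D} (h : IsInstantiation σ) (v : Var D) :
    σ v = v ∨ ∃ d : D, σ v = Sum.inr d := by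
  cases v with
  | inl n => exact h.2 n
  | inr d => exact Or.inl (h.1 d)

theorem update {σ : Var D → Var D} (h : IsInstantiation σ) (x : ℕ) :
    IsInstantiation (Function.update σ (Sum.inl x) (Sum.inl x)) := by
  refine ⟨fun d => by simp [h.1 d], fun n => ?_⟩
  by_cases hn : n = x
  · simp [hn]
  · rw [Function.update_of_ne (by simpa using hn)]
    exact h.2 n

theorem ite {σ : Var D → Var D} (h : IsInstantiation σ) (X : Finset (Var D)) :
    IsInstantiation (fun v => if v ∈ X then σ v else v) := by
  refine ⟨fun d => by simp [h.1 d], fun n => ?_⟩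
  by_cases hn : Sum.inl n ∈ X
  · simpa [hn] using h.2 n
  · simp [hn]

theorem single (x : ℕ) (d : D) : IsInstantiation (single x (Sum.inr d) : Var D → Var D) := by
  refine ⟨fun d => by simp [Fml.single], fun n => ?_⟩
  by_cases hn : n = x
  · simp [hn, Fml.single]
  · left
    simp [Fml.single, hn]

/-- An instantiation moves no member of a subscript onto a symbol free only inside the box. -/
theorem ne_of_notMem {σ : Var D → Var D} (h : IsInstantiation σ) {X : Finset (Var D)} {φ : Fml D}
    (hX : consts φ ⊆ X) {z y : Var D} (hz : z ∈ X) (hy : y ∈ fv φ) (hyX : y ∉ X) : σ z ≠ y := by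
  rcases h.eq_self_or z with h1 | ⟨d, h1⟩
  · rw [h1]
    rintro rfl
    exact hyX hz
  · rw [h1]
    rintro rfl
    exact hyX (hX (inr_mem_consts_of_mem_fv hy))

/-- Constants are never bound, and in a `D`-formula every constant free inside a box already belongs
to the subscript, so nothing can be captured. -/
theorem freeFor {φ : Fml D} (hD : IsDFormula φ) :
    ∀ {σ : Var D → Var D}, IsInstantiation σ → FreeFor σ φ := by
  induction φ with
  | pred n P args => intros; trivial
  | bot => intros; trivial
  | imp φ ψ ih1 ih2 => intro σ h; exact ⟨ih1 hD.1 h, ih2 hD.2 h⟩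
  | all x φ ih =>
    intro σ h
    refine ⟨fun z hz => ?_, ih hD (h.update x)⟩
    rcases h.eq_self_or z with h1 | ⟨d, h1⟩
    · rw [h1]
      exact (Finset.mem_erase.1 hz).1
    · simp [h1]
  | box t X φ ih =>
    intro σ h
    exact ⟨fun z hz y hy hyX => h.ne_of_notMem hD.1 hz hy hyX, ih hD.2 (h.ite X)⟩

theorem mem_consts_subst {φ : Fml D} :
    ∀ {σ : Var D → Var D}, IsInstantiation σ → ∀ {v : Var D}, v ∈ consts (subst σ φ) →
      v ∈ consts φ ∨ ∃ w ∈ fv φ, v = σ w := by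
  induction φ with
  | pred n P args =>
    intro σ h v hv
    simp only [subst, consts, Finset.mem_filter, Finset.mem_image, Finset.mem_univ,
      true_and] at hv
    obtain ⟨⟨i, hi⟩, _⟩ := hv
    exact Or.inr ⟨args i, by simp [fv], hi.symm⟩
  | bot => intro σ h v hv; simp [subst, consts] at hv
  | imp φ ψ ih1 ih2 =>
    intro σ h v hv
    simp only [subst, consts, fv, Finset.mem_union] at hv ⊢
    rcases hv with hv | hv
    · rcases ih1 h hv with h1 | ⟨w, hw, h1⟩
      · exact Or.inl (Or.inl h1)
      · exact Or.inr ⟨w, Or.inl hw, h1⟩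
    · rcases ih2 h hv with h1 | ⟨w, hw, h1⟩
      · exact Or.inl (Or.inr h1)
      · exact Or.inr ⟨w, Or.inr hw, h1⟩
  | all x φ ih =>
    intro σ h v hv
    simp only [subst, consts] at hv
    rcases ih (h.update x) hv with h1 | ⟨w, hw, h1⟩
    · exact Or.inl h1
    · by_cases hx : w = Sum.inl x
      · subst hx
        obtain ⟨d, hd⟩ := exists_inr_of_mem_consts hv
        simp [hd] at h1
      · rw [Function.update_of_ne hx] at h1
        exact Or.inr ⟨w, Finset.mem_erase.2 ⟨hx, hw⟩, h1⟩
  | box t X φ ih =>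
    intro σ h v hv
    simp only [subst, consts, fv, Finset.mem_union, Finset.mem_filter, Finset.mem_image] at hv ⊢
    rcases hv with ⟨⟨w, hw, h1⟩, _⟩ | hv
    · exact Or.inr ⟨w, hw, h1.symm⟩
    · obtain ⟨d, rfl⟩ := exists_inr_of_mem_consts hv
      rcases ih (h.ite X) hv with h1 | ⟨w, hw, h1⟩
      · exact Or.inl (Or.inr h1)
      · split_ifs at h1 with hX
        · exact Or.inr ⟨w, hX, h1⟩
        · exact Or.inl (Or.inr (inr_mem_consts_of_mem_fv (h1 ▸ hw)))

/-- Under a box only members of the subscript are moved, so a constant of the new body is either an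
old one, which `σ` fixes, or the image of a member of the subscript. -/
theorem isDFormula_subst {φ : Fml D} (hD : IsDFormula φ) :
    ∀ {σ : Var D → Var D}, IsInstantiation σ → IsDFormula (subst σ φ) := by
  induction φ with
  | pred n P args => intros; trivial
  | bot => intros; trivial
  | imp φ ψ ih1 ih2 => intro σ h; exact ⟨ih1 hD.1 h, ih2 hD.2 h⟩
  | all x φ ih => intro σ h; exact ih hD (h.update x)
  | box t X φ ih =>
    intro σ h
    refine ⟨fun v hv => ?_, ih hD.2 (h.ite X)⟩
    have key : v ∈ consts φ → v ∈ X.image σ := fun h1 => by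
      obtain ⟨d, rfl⟩ := exists_inr_of_mem_consts h1
      exact Finset.mem_image.2 ⟨_, hD.1 h1, h.1 d⟩
    rcases (h.ite X).mem_consts_subst hv with h1 | ⟨w, hw, h1⟩
    · exact key h1
    · split_ifs at h1 with hX
      · exact Finset.mem_image.2 ⟨w, hX, h1.symm⟩
      · obtain ⟨d, rfl⟩ := exists_inr_of_mem_consts hv
        exact key (inr_mem_consts_of_mem_fv (h1 ▸ hw))

/-- The point is that `σ` brings nothing new under the control of a quantifier or subscript: a
symbol outside `X` stays outside the image of `X`. -/
theorem subst_subst {φ : Fml D} (hD : IsDFormula φ) :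
    ∀ {σ τ ρ : Var D → Var D}, IsInstantiation σ →
      (∀ v ∈ fv φ, τ (σ v) = ρ v) → subst τ (subst σ φ) = subst ρ φ := by
  induction φ with
  | pred n P args =>
    intro σ τ ρ _ h
    simp only [subst]
    congr 1
    funext i
    exact h _ (by simp [fv])
  | bot => intros; rfl
  | imp φ ψ ih1 ih2 =>
    intro σ τ ρ hσ h
    simp only [fv, Finset.mem_union] at h
    simp only [subst]
    rw [ih1 hD.1 hσ fun v hv => h v (Or.inl hv), ih2 hD.2 hσ fun v hv => h v (Or.inr hv)]
  | all x φ ih =>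
    intro σ τ ρ hσ h
    simp only [subst]
    rw [ih hD (hσ.update x)]
    intro v hv
    by_cases hx : v = Sum.inl x
    · simp [hx]
    · rw [Function.update_of_ne hx, Function.update_of_ne hx, Function.update_of_ne]
      · exact h v (Finset.mem_erase.2 ⟨hx, hv⟩)
      · rcases hσ.eq_self_or v with h1 | ⟨d, h1⟩
        · rwa [h1]
        · simp [h1]
  | box t X φ ih =>
    intro σ τ ρ hσ h
    simp only [fv] at h
    simp only [subst]
    rw [ih hD.2 (ρ := fun v => if v ∈ X then ρ v else v) (hσ.ite X)]
    · congr 1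
      rw [Finset.image_image]
      exact Finset.image_congr fun v hv => h v hv
    · intro v hv
      by_cases hX : v ∈ X
      · simp only [hX, if_true, Finset.mem_image_of_mem σ hX, h v hX]
      · have : v ∉ X.image σ := fun hm => by
          obtain ⟨w, hw, h1⟩ := Finset.mem_image.1 hm
          exact hσ.ne_of_notMem hD.1 hw hv hX h1
        simp only [hX, if_false, this]

end IsInstantiation

/-! ### Trivial substitutions and universal closures -/

theorem single_self (x : ℕ) : (single x (Sum.inl x) : Var D → Var D) = id := by
  simp [single]

theorem subst1_self (x : ℕ) (φ : Fml D) : subst1 x (Sum.inl x) φ = φ := by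
  rw [subst1, single_self]
  exact subst_eq_self fun v _ => rfl

theorem freeFor_id (φ : Fml D) : FreeFor id φ := by
  induction φ with
  | pred n P args => trivial
  | bot => trivial
  | imp φ ψ ih1 ih2 => exact ⟨ih1, ih2⟩
  | all x φ ih =>
    refine ⟨fun z hz => (Finset.mem_erase.1 hz).1, ?_⟩
    rw [show Function.update id (Sum.inl x) (Sum.inl x) = (id : Var D → Var D) by simp]
    exact ih
  | box t X φ ih =>
    refine ⟨fun z hz y _ hy h => hy (h ▸ hz), ?_⟩
    rw [show (fun v => if v ∈ X then id v else v) = (id : Var D → Var D) by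
      funext v; exact ite_self v]
    exact ih

theorem isDFormula_alls {ys : List ℕ} {φ : Fml D} (h : IsDFormula φ) : IsDFormula (alls ys φ) := by
  induction ys with
  | nil => exact h
  | cons y ys ih => exact ih

theorem subst1_alls {y : ℕ} {v : Var D} {ys : List ℕ} {φ : Fml D} (h : y ∉ ys) :
    subst1 y v (alls ys φ) = alls ys (subst1 y v φ) := by
  induction ys with
  | nil => rfl
  | cons z ys ih =>
    simp only [List.mem_cons, not_or] at h
    simp only [alls, List.foldr_cons] at ih ⊢
    rw [← ih h.2]
    simp only [subst1, subst]
    congr 2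
    apply Function.update_eq_self_iff.2
    simp [single, Ne.symm h.1]

/-! ### Replacing a domain constant by a basic variable -/

/-- The symbol map that sends the constant `a` to the basic variable `y`. -/
def repMap (a : D) (y : ℕ) : Var D → Var D := Function.update id (Sum.inr a) (Sum.inl y)

/-- Literal replacement of all occurrences of the constant `a` by the basic variable `y`. -/
def rep (a : D) (y : ℕ) : Fml D → Fml D
  | pred n P args => pred n P (fun i => repMap a y (args i))
  | bot => bot
  | imp φ ψ => imp (rep a y φ) (rep a y ψ)
  | all x φ => all x (rep a y φ)
  | box t X φ => box t (X.image (repMap a y)) (rep a y φ)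

@[simp] theorem repMap_inl (a : D) (y n : ℕ) : repMap a y (Sum.inl n) = Sum.inl n := by
  simp [repMap]

theorem repMap_of_ne {a : D} (y : ℕ) {v : Var D} (h : v ≠ Sum.inr a) : repMap a y v = v := by
  simp [repMap, Function.update_of_ne h]

@[simp] theorem repMap_self (a : D) (y : ℕ) : repMap a y (Sum.inr a) = Sum.inl y := by
  simp [repMap]

/-- The only two symbols that are merged are `a` and `y`. -/
theorem repMap_inj {a : D} {y : ℕ} {v w : Var D} (hv : v ≠ Sum.inl y) (hw : w ≠ Sum.inl y) :
    repMap a y v = repMap a y w ↔ v = w := by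
  refine ⟨fun h => ?_, congrArg _⟩
  by_cases h1 : v = Sum.inr a <;> by_cases h2 : w = Sum.inr a
  · rw [h1, h2]
  · rw [h1, repMap_self, repMap_of_ne y h2] at h
    exact absurd h.symm hw
  · rw [h2, repMap_self, repMap_of_ne y h1] at h
    exact absurd h hv
  · rwa [repMap_of_ne y h1, repMap_of_ne y h2] at h

theorem repMap_mem_image {a : D} {y : ℕ} {v : Var D} {X : Finset (Var D)} (hv : v ≠ Sum.inl y)
    (hX : Sum.inl y ∉ X) : repMap a y v ∈ X.image (repMap a y) ↔ v ∈ X := by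
  refine ⟨fun h => ?_, Finset.mem_image_of_mem _⟩
  obtain ⟨w, hw, h1⟩ := Finset.mem_image.1 h
  rw [repMap_inj (ne_of_mem_of_not_mem hw hX) hv] at h1
  exact h1 ▸ hw

/-- Freshness is demanded of all symbols, bound ones included: a quantifier over `y` would capture
the replaced occurrences of `a`. -/
theorem fv_rep {a : D} {y : ℕ} {φ : Fml D} (hy : Sum.inl y ∉ vars φ) :
    fv (rep a y φ) = (fv φ).image (repMap a y) := by
  induction φ with
  | pred n P args =>
    simp only [rep, fv, Finset.image_image]
    rfl
  | bot => simp [rep, fv]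
  | imp φ ψ ih1 ih2 =>
    simp only [vars, Finset.mem_union, not_or] at hy
    simp only [rep, fv, Finset.image_union, ih1 hy.1, ih2 hy.2]
  | all x φ ih =>
    simp only [vars, Finset.mem_insert, not_or] at hy
    simp only [rep, fv, ih hy.2]
    ext v
    simp only [Finset.mem_erase, Finset.mem_image]
    constructor
    · rintro ⟨h1, w, hw, rfl⟩
      refine ⟨w, ⟨?_, hw⟩, rfl⟩
      rintro rfl
      exact h1 (repMap_inl _ _ _)
    · rintro ⟨w, ⟨h1, hw⟩, rfl⟩
      refine ⟨fun h => h1 ?_, w, hw, rfl⟩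
      rw [← repMap_inl a y x,
        repMap_inj (ne_of_mem_of_not_mem (fv_subset_vars _ hw) hy.2) (Ne.symm hy.1)] at h
      exact h
  | box t X φ ih => simp [rep, fv]

theorem consts_rep (a : D) (y : ℕ) (φ : Fml D) :
    consts (rep a y φ) = (consts φ).erase (Sum.inr a) := by
  have key : ∀ X : Finset (Var D), (X.image (repMap a y)).filter (fun v => v.isRight) =
      (X.filter (fun v => v.isRight)).erase (Sum.inr a) := fun X => by
    ext v
    simp only [Finset.mem_filter, Finset.mem_image, Finset.mem_erase]
    constructor
    · rintro ⟨⟨w, hw, rfl⟩, h⟩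
      by_cases hwa : w = Sum.inr a
      · simp [hwa] at h
      · rw [repMap_of_ne y hwa] at h ⊢
        exact ⟨hwa, hw, h⟩
    · rintro ⟨h1, h2, h3⟩
      exact ⟨⟨v, h2, repMap_of_ne y h1⟩, h3⟩
  induction φ with
  | pred n P args =>
    simp only [rep, consts]
    rw [← key, Finset.image_image]
    rfl
  | bot => simp [rep, consts]
  | imp φ ψ ih1 ih2 => simp only [rep, consts, ih1, ih2, Finset.erase_union_distrib]
  | all x φ ih => simpa only [rep, consts] using ih
  | box t X φ ih => simp only [rep, consts, ih, key, Finset.erase_union_distrib]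

theorem isDFormula_rep (a : D) (y : ℕ) {φ : Fml D} (h : IsDFormula φ) :
    IsDFormula (rep a y φ) := by
  induction φ with
  | pred n P args => trivial
  | bot => trivial
  | imp φ ψ ih1 ih2 => exact ⟨ih1 h.1, ih2 h.2⟩
  | all x φ ih => exact ih h
  | box t X φ ih =>
    refine ⟨fun v hv => ?_, ih h.2⟩
    rw [consts_rep, Finset.mem_erase] at hv
    exact Finset.mem_image.2 ⟨v, h.1 hv.2, repMap_of_ne y hv.1⟩

/-- `rep` acts on every occurrence but `subst` only on free ones. In a `D`-formula the constants are
all free, so the replacement can be undone. -/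
theorem subst_rep {a : D} {y : ℕ} {φ : Fml D} (hD : IsDFormula φ) (hy : Sum.inl y ∉ vars φ) :
    ∀ {σ : Var D → Var D}, (∀ v ∈ fv φ, σ (repMap a y v) = v) → subst σ (rep a y φ) = φ := by
  induction φ with
  | pred n P args =>
    intro σ h
    simp only [rep, subst]
    congr 1
    funext i
    exact h _ (by simp [fv])
  | bot => intros; rfl
  | imp φ ψ ih1 ih2 =>
    intro σ h
    simp only [vars, fv, Finset.mem_union, not_or] at h hy
    rw [rep, subst, ih1 hD.1 hy.1 fun v hv => h v (Or.inl hv),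
      ih2 hD.2 hy.2 fun v hv => h v (Or.inr hv)]
  | all x φ ih =>
    intro σ h
    simp only [vars, Finset.mem_insert, not_or] at hy
    rw [rep, subst, ih hD hy.2]
    intro v hv
    by_cases hx : v = Sum.inl x
    · simp [hx]
    · rw [Function.update_of_ne]
      · exact h v (Finset.mem_erase.2 ⟨hx, hv⟩)
      · intro h1
        rw [← repMap_inl a y x,
          repMap_inj (ne_of_mem_of_not_mem (fv_subset_vars _ hv) hy.2) (Ne.symm hy.1)] at h1
        exact hx h1
  | box t X φ ih =>
    intro σ h
    simp only [vars, fv, Finset.mem_union, not_or] at h hy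
    rw [rep, subst, ih hD.2 hy.2]
    · congr 1
      rw [Finset.image_image]
      exact (Finset.image_congr (g := id) fun v hv => h v hv).trans Finset.image_id
    · intro v hv
      have hvy : v ≠ Sum.inl y := ne_of_mem_of_not_mem (fv_subset_vars _ hv) hy.2
      simp only [repMap_mem_image hvy hy.1]
      split_ifs with hX
      · exact h v hX
      · apply repMap_of_ne
        rintro rfl
        exact hX (hD.1 (inr_mem_consts_of_mem_fv hv))

theorem subst1_rep {a : D} {y : ℕ} {φ : Fml D} (hD : IsDFormula φ) (hy : Sum.inl y ∉ vars φ) :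
    subst1 y (Sum.inr a) (rep a y φ) = φ := by
  refine subst_rep hD hy fun v hv => ?_
  by_cases hva : v = Sum.inr a
  · simp [hva, single]
  · rw [repMap_of_ne y hva, single,
      Function.update_of_ne (ne_of_mem_of_not_mem (fv_subset_vars _ hv) hy)]
    rfl

theorem rep_subst {a : D} {y : ℕ} {φ : Fml D} (hy : Sum.inl y ∉ vars φ) :
    ∀ {σ τ : Var D → Var D}, (∀ v ∈ fv φ, τ (repMap a y v) = repMap a y (σ v)) →
      rep a y (subst σ φ) = subst τ (rep a y φ) := by
  induction φ with
  | pred n P args =>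
    intro σ τ h
    simp only [rep, subst]
    congr 1
    funext i
    exact (h _ (by simp [fv])).symm
  | bot => intros; rfl
  | imp φ ψ ih1 ih2 =>
    intro σ τ h
    simp only [vars, fv, Finset.mem_union, not_or] at h hy
    simp only [rep, subst, ih1 hy.1 fun v hv => h v (Or.inl hv),
      ih2 hy.2 fun v hv => h v (Or.inr hv)]
  | all x φ ih =>
    intro σ τ h
    simp only [vars, Finset.mem_insert, not_or] at hy
    simp only [rep, subst]
    rw [ih hy.2]
    intro v hv
    by_cases hx : v = Sum.inl x
    · simp [hx]
    · rw [Function.update_of_ne hx, Function.update_of_ne]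
      · exact h v (Finset.mem_erase.2 ⟨hx, hv⟩)
      · intro h1
        rw [← repMap_inl a y x,
          repMap_inj (ne_of_mem_of_not_mem (fv_subset_vars _ hv) hy.2) (Ne.symm hy.1)] at h1
        exact hx h1
  | box t X φ ih =>
    intro σ τ h
    simp only [vars, fv, Finset.mem_union, not_or] at h hy
    simp only [rep, subst]
    rw [ih hy.2]
    · congr 1
      rw [Finset.image_image, Finset.image_image]
      exact Finset.image_congr fun v hv => (h v hv).symm
    · intro v hv
      have hvy : v ≠ Sum.inl y := ne_of_mem_of_not_mem (fv_subset_vars _ hv) hy.2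
      simp only [repMap_mem_image hvy hy.1]
      split_ifs with hX
      · exact h v hX
      · rfl

/-- A capture after the replacement would be an equality between values of `repMap`. As neither side
came from `y`, injectivity pulls it back to a capture by `σ`. -/
theorem freeFor_rep {a : D} {y : ℕ} {φ : Fml D} (hy : Sum.inl y ∉ vars φ) :
    ∀ {σ τ : Var D → Var D}, (∀ v ∈ fv φ, τ (repMap a y v) = repMap a y (σ v)) →
      (∀ v ∈ fv φ, σ v ≠ Sum.inl y) → FreeFor σ φ → FreeFor τ (rep a y φ) := by
  induction φ with
  | pred n P args => intros; trivial
  | bot => intros; trivial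
  | imp φ ψ ih1 ih2 =>
    intro σ τ h h' hF
    simp only [vars, fv, Finset.mem_union, not_or] at h h' hy
    exact ⟨ih1 hy.1 (fun v hv => h v (Or.inl hv)) (fun v hv => h' v (Or.inl hv)) hF.1,
      ih2 hy.2 (fun v hv => h v (Or.inr hv)) (fun v hv => h' v (Or.inr hv)) hF.2⟩
  | all x φ ih =>
    intro σ τ h h' hF
    have hfv := fv_rep (a := a) hy
    simp only [vars, Finset.mem_insert, not_or] at hy
    refine ⟨fun z hz => ?_, ih hy.2 (σ := Function.update σ (Sum.inl x) (Sum.inl x)) ?_ ?_ hF.2⟩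
    · rw [rep] at hfv
      rw [hfv] at hz
      obtain ⟨w, hw, rfl⟩ := Finset.mem_image.1 hz
      rw [h w hw, ← repMap_inl a y x, Ne, repMap_inj (h' w hw) (Ne.symm hy.1)]
      exact hF.1 w hw
    · intro v hv
      by_cases hx : v = Sum.inl x
      · simp [hx]
      · rw [Function.update_of_ne hx, Function.update_of_ne]
        · exact h v (Finset.mem_erase.2 ⟨hx, hv⟩)
        · intro h1
          rw [← repMap_inl a y x,
            repMap_inj (ne_of_mem_of_not_mem (fv_subset_vars _ hv) hy.2) (Ne.symm hy.1)] at h1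
          exact hx h1
    · intro v hv
      by_cases hx : v = Sum.inl x
      · simpa [hx] using Ne.symm hy.1
      · rw [Function.update_of_ne hx]
        exact h' v (Finset.mem_erase.2 ⟨hx, hv⟩)
  | box t X φ ih =>
    intro σ τ h h' hF
    simp only [vars, fv, Finset.mem_union, not_or] at h h' hy
    have hne : ∀ v ∈ fv φ, v ≠ Sum.inl y := fun v hv =>
      ne_of_mem_of_not_mem (fv_subset_vars _ hv) hy.2
    refine ⟨fun z hz w hw hwX => ?_,
      ih hy.2 (σ := fun v => if v ∈ X then σ v else v) ?_ ?_ hF.2⟩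
    · rw [fv_rep hy.2] at hw
      obtain ⟨z₀, hz₀, rfl⟩ := Finset.mem_image.1 hz
      obtain ⟨w₀, hw₀, rfl⟩ := Finset.mem_image.1 hw
      rw [h z₀ hz₀, Ne, repMap_inj (h' z₀ hz₀) (hne w₀ hw₀)]
      exact hF.1 z₀ hz₀ w₀ hw₀ fun hX => hwX (Finset.mem_image_of_mem _ hX)
    · intro v hv
      simp only [repMap_mem_image (hne v hv) hy.1]
      split_ifs with hX
      · exact h v hX
      · rfl
    · intro v hv
      split_ifs with hX
      · exact h' v hX
      · exact hne v hv

end Fml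

/-! ### Axioms under replacement of a constant -/

open Fml

variable {D : Type u} [DecidableEq D]

/-- Freshness is phrased as an eventual property so that several such demands can be met by one
variable. -/
theorem eventually_inl_notMem (X : Finset (Var D)) :
    ∀ᶠ y : ℕ in Filter.atTop, Sum.inl y ∉ X := by
  induction X using Finset.cons_induction with
  | empty => simp
  | cons v X hv ih =>
    have : ∀ᶠ y : ℕ in Filter.atTop, Sum.inl y ≠ v := by
      cases v with
      | inl n =>
        filter_upwards [Filter.eventually_gt_atTop n] with y hy h
        cases h
        exact lt_irrefl _ hy
      | inr d => simp
    filter_upwards [ih, this] with y h1 h2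
    simp [h1, h2]

/-- Replacing a constant by a fresh basic variable turns axioms into axioms. -/
theorem IsAxiom.rep {φ : Fml D} (h : IsAxiom φ) (a : D) :
    ∀ᶠ y : ℕ in Filter.atTop, IsAxiom (rep a y φ) := by
  cases h with
  | a1_k φ ψ => exact .of_forall fun y => .a1_k _ _
  | a1_s φ ψ χ => exact .of_forall fun y => .a1_s _ _ _
  | a1_dne φ => exact .of_forall fun y => .a1_dne _
  | a1_inst x z φ h =>
    -- The instantiating symbol `z` and the variable `x` need not occur in `φ`, so they are avoided
    -- separately.
    filter_upwards [eventually_inl_notMem (vars φ), eventually_inl_notMem ({z, Sum.inl x} : Finset (Var D))]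
      with y hy hz
    simp only [Finset.mem_insert, Finset.mem_singleton, not_or] at hz
    have key : ∀ v ∈ fv φ, single x (repMap a y z) (repMap a y v) =
        repMap a y (single x z v) := fun v hv => by
      by_cases hx : v = Sum.inl x
      · simp [hx, single]
      · rw [single, single, Function.update_of_ne hx, Function.update_of_ne]
        · rfl
        · intro h1
          rw [← repMap_inl a y x,
            repMap_inj (ne_of_mem_of_not_mem (fv_subset_vars _ hv) hy) (Ne.symm hz.2)] at h1
          exact hx h1
    have key' : ∀ v ∈ fv φ, single x z v ≠ Sum.inl y := fun v hv => by
      by_cases hx : v = Sum.inl x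
      · simpa [hx, single] using Ne.symm hz.1
      · rw [single, Function.update_of_ne hx]
        exact ne_of_mem_of_not_mem (fv_subset_vars _ hv) hy
    simp only [Fml.rep, subst1]
    rw [rep_subst hy key]
    exact .a1_inst _ _ _ (freeFor_rep hy key key' h)
  | a1_all x φ ψ h =>
    filter_upwards [eventually_inl_notMem (vars φ),
      eventually_inl_notMem ({Sum.inl x} : Finset (Var D))] with y hy hx
    refine .a1_all _ _ _ ?_
    rw [fv_rep hy, ← repMap_inl a y x, repMap_mem_image (by simpa [eq_comm] using hx)
      (fun h => hy (fv_subset_vars _ h))]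
    exact h
  | a2 t X z φ hX hz =>
    filter_upwards [eventually_inl_notMem (vars φ), eventually_inl_notMem (insert z X)] with y hy hx
    simp only [Finset.mem_insert, not_or] at hx
    simp only [Fml.rep, Finset.image_insert]
    refine .a2 _ _ _ _ ?_ ?_
    · rwa [repMap_mem_image (Ne.symm hx.1) hx.2]
    · rwa [fv_rep hy, repMap_mem_image (Ne.symm hx.1) (fun h => hy (fv_subset_vars _ h))]
  | a3 t X z φ hX =>
    filter_upwards [eventually_inl_notMem (insert z X)] with y hx
    simp only [Finset.mem_insert, not_or] at hx
    simp only [Fml.rep, Finset.image_insert]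
    refine .a3 _ _ _ _ ?_
    rwa [repMap_mem_image (Ne.symm hx.1) hx.2]
  | b1 t X φ => exact .of_forall fun y => .b1 _ _ _
  | b2 t s X φ ψ => exact .of_forall fun y => .b2 _ _ _ _ _
  | b3_left t s X φ => exact .of_forall fun y => .b3_left _ _ _ _
  | b3_right t s X φ => exact .of_forall fun y => .b3_right _ _ _ _
  | b4 t X φ => exact .of_forall fun y => .b4 _ _ _
  | b5 t X x φ hx =>
    filter_upwards [eventually_inl_notMem (insert (Sum.inl x) X)] with y hy
    simp only [Finset.mem_insert, not_or] at hy
    refine .b5 _ _ _ _ ?_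
    rwa [← repMap_inl a y x, repMap_mem_image (Ne.symm hy.1) hy.2]
  | bb t X x φ hx =>
    filter_upwards [eventually_inl_notMem (insert (Sum.inl x) X)] with y hy
    simp only [Finset.mem_insert, not_or] at hy
    simp only [Fml.rep, Finset.image_insert, repMap_inl]
    refine .bb _ _ _ _ ?_
    rwa [← repMap_inl a y x, repMap_mem_image (Ne.symm hy.1) hy.2]

/-! ### Derivations: deduction theorem, compactness, quantifiers and subscripts -/

namespace Derives

variable {A Γ Δ : Set (Fml D)} {φ ψ χ : Fml D}

theorem isDFormula (hA : ∀ φ ∈ A, IsDFormula φ) (h : Derives A Γ φ) (hΓ : ∀ φ ∈ Γ, IsDFormula φ) :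
    IsDFormula φ := by
  induction h with
  | ax h hD => exact hD
  | cs h => exact hA _ h
  | hyp h => exact hΓ _ h
  | mp h1 h2 ih1 ih2 => exact (ih1 hΓ).2
  | gen x hx h ih => exact ih hΓ
  | weaken hs h ih => exact ih fun φ hφ => hΓ φ (hs hφ)

theorem mono_axioms {B : Set (Fml D)} (hAB : A ⊆ B) (h : Derives A Γ φ) : Derives B Γ φ := by
  induction h with
  | ax h hD => exact .ax h hD
  | cs h => exact .cs (hAB h)
  | hyp h => exact .hyp h
  | mp h1 h2 ih1 ih2 => exact .mp ih1 ih2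
  | gen x hx h ih => exact .gen x hx ih
  | weaken hs h ih => exact .weaken hs ih

theorem of_empty (h : Derives A ∅ φ) : Derives A Γ φ := h.weaken (Set.empty_subset _)

theorem imp_intro_const (hφ : IsDFormula φ) (hψ : IsDFormula ψ) (h : Derives A Γ ψ) :
    Derives A Γ (imp φ ψ) :=
  .mp (.ax (.a1_k ψ φ) ⟨hψ, hφ, hψ⟩) h

theorem imp_self (hφ : IsDFormula φ) : Derives A Γ (imp φ φ) :=
  .mp (.mp (.ax (.a1_s φ (imp φ φ) φ) ⟨⟨hφ, ⟨hφ, hφ⟩, hφ⟩, ⟨hφ, hφ, hφ⟩, hφ, hφ⟩)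
    (.ax (.a1_k φ (imp φ φ)) ⟨hφ, ⟨hφ, hφ⟩, hφ⟩)) (.ax (.a1_k φ φ) ⟨hφ, hφ, hφ⟩)

/-- Removing `φ`, rather than assuming it was inserted, suits the weakening rule, which passes to
subsets with or without `φ`. At a generalization, either `φ` is a hypothesis and `x` is not free in
it, or nothing is removed and the step is kept. -/
theorem deduction_diff (hA : ∀ φ ∈ A, IsDFormula φ) (hφ : IsDFormula φ) (h : Derives A Γ ψ)
    (hΓ : ∀ φ ∈ Γ, IsDFormula φ) : Derives A (Γ \ {φ}) (imp φ ψ) := by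
  induction h with
  | ax h hD => exact imp_intro_const hφ hD (.ax h hD)
  | cs h => exact imp_intro_const hφ (hA _ h) (.cs h)
  | @hyp Γ χ h =>
    by_cases hχ : χ = φ
    · subst hχ
      exact imp_self hφ
    · exact imp_intro_const hφ (hΓ _ h) (.hyp ⟨h, hχ⟩)
  | @mp Γ χ ψ h1 h2 ih1 ih2 =>
    have hD : IsDFormula (imp χ ψ) := h1.isDFormula hA hΓ
    exact .mp (.mp (.ax (.a1_s φ χ ψ) ⟨⟨hφ, hD⟩, ⟨hφ, hD.1⟩, hφ, hD.2⟩) (ih1 hΓ)) (ih2 hΓ)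
  | @gen Γ χ x hx h ih =>
    have hD : IsDFormula χ := h.isDFormula hA hΓ
    by_cases hφΓ : φ ∈ Γ
    · exact .mp (.ax (.a1_all x φ χ (hx φ hφΓ)) ⟨⟨hφ, hD⟩, hφ, hD⟩)
        (.gen x (fun ψ hψ => hx ψ hψ.1) (ih hΓ))
    · rw [Set.sdiff_singleton_eq_self hφΓ]
      exact imp_intro_const hφ hD (.gen x hx h)
  | weaken hs h ih =>
    exact .weaken (Set.sdiff_subset_sdiff_left hs) (ih fun φ hφ => hΓ φ (hs hφ))

theorem deduction (hA : ∀ φ ∈ A, IsDFormula φ) (hΓ : ∀ φ ∈ Γ, IsDFormula φ) (hφ : IsDFormula φ)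
    (h : Derives A (insert φ Γ) ψ) : Derives A Γ (imp φ ψ) := by
  refine .weaken ?_ (deduction_diff hA hφ h ?_)
  · rintro χ ⟨h1 | h1, h2⟩
    · exact absurd h1 h2
    · exact h1
  · rintro χ (rfl | h1)
    · exact hφ
    · exact hΓ χ h1

theorem exists_finite (h : Derives A Γ φ) : ∃ Γ₀ ⊆ Γ, Γ₀.Finite ∧ Derives A Γ₀ φ := by
  induction h with
  | ax h hD => exact ⟨∅, Set.empty_subset _, Set.finite_empty, .ax h hD⟩
  | cs h => exact ⟨∅, Set.empty_subset _, Set.finite_empty, .cs h⟩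
  | @hyp Γ φ h => exact ⟨{φ}, by simpa using h, Set.finite_singleton _, .hyp rfl⟩
  | mp h1 h2 ih1 ih2 =>
    obtain ⟨Γ₁, hs1, hf1, hd1⟩ := ih1
    obtain ⟨Γ₂, hs2, hf2, hd2⟩ := ih2
    exact ⟨Γ₁ ∪ Γ₂, Set.union_subset hs1 hs2, hf1.union hf2,
      .mp (hd1.weaken Set.subset_union_left) (hd2.weaken Set.subset_union_right)⟩
  | gen x hx h ih =>
    obtain ⟨Γ₁, hs1, hf1, hd1⟩ := ih
    exact ⟨Γ₁, hs1, hf1, .gen x (fun ψ hψ => hx ψ (hs1 hψ)) hd1⟩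
  | weaken hs h ih =>
    obtain ⟨Γ₁, hs1, hf1, hd1⟩ := ih
    exact ⟨Γ₁, hs1.trans hs, hf1, hd1⟩

/-- Finitely many hypotheses taken from `Δ` can be moved into the derived formula. -/
theorem exists_foldr (hA : ∀ φ ∈ A, IsDFormula φ) (hΓ : ∀ φ ∈ Γ, IsDFormula φ)
    (hΔ : ∀ φ ∈ Δ, IsDFormula φ) (h : Derives A (Γ ∪ Δ) φ) :
    ∃ L : List (Fml D), (∀ ψ ∈ L, ψ ∈ Δ) ∧ Derives A Γ (L.foldr imp φ) := by
  obtain ⟨Γ₀, hs, hf, hd⟩ := h.exists_finite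
  have key : ∀ Δ₀ : Set (Fml D), Δ₀.Finite → Δ₀ ⊆ Δ → ∀ φ, Derives A (Γ ∪ Δ₀) φ →
      ∃ L : List (Fml D), (∀ ψ ∈ L, ψ ∈ Δ) ∧ Derives A Γ (L.foldr imp φ) := by
    intro Δ₀ hfin
    induction Δ₀, hfin using Set.Finite.induction_on with
    | empty => exact fun _ φ h => ⟨[], by simp, by simpa using h⟩
    | @insert χ Δ₀ _ _ ih =>
      intro hsub φ h
      rw [Set.insert_subset_iff] at hsub
      have h' : Derives A (Γ ∪ Δ₀) (imp χ φ) := by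
        refine deduction hA ?_ (hΔ χ hsub.1) (by rwa [Set.union_insert] at h)
        rintro ψ (h1 | h1)
        · exact hΓ ψ h1
        · exact hΔ ψ (hsub.2 h1)
      obtain ⟨L, hL, hd⟩ := ih hsub.2 _ h'
      refine ⟨L ++ [χ], ?_, by simpa using hd⟩
      simpa [or_imp, forall_and] using ⟨hL, hsub.1⟩
  refine key (Γ₀ ∩ Δ) (hf.subset Set.inter_subset_left) Set.inter_subset_right φ (hd.weaken ?_)
  intro ψ hψ
  exact (hs hψ).imp id fun h => ⟨hψ, h⟩

theorem mp_foldr {L : List (Fml D)} (hL : ∀ ψ ∈ L, Derives A Γ ψ)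
    (h : Derives A Γ (L.foldr imp φ)) : Derives A Γ φ := by
  induction L with
  | nil => exact h
  | cons χ L ih =>
    exact ih (fun ψ hψ => hL ψ (List.mem_cons_of_mem _ hψ)) (.mp h (hL χ List.mem_cons_self))

/-- Replaying the derivation over `Γ` could violate the condition on generalization. Instead, the
finitely many hypotheses used become antecedents of an implication derived from no hypotheses. -/
theorem cut (hA : ∀ φ ∈ A, IsDFormula φ) (hΔ : ∀ φ ∈ Δ, IsDFormula φ)
    (h : Derives A Δ φ) (hΓ : ∀ ψ ∈ Δ, Derives A Γ ψ) : Derives A Γ φ := by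
  obtain ⟨L, hL, hd⟩ := exists_foldr (Γ := ∅) hA (by simp) hΔ (by simpa using h)
  exact mp_foldr (fun ψ hψ => hΓ ψ (hL ψ hψ)) hd.of_empty

theorem of_neg_neg (hφ : IsDFormula φ) (h : Derives A Γ (neg (neg φ))) : Derives A Γ φ :=
  .mp (.ax (.a1_dne φ) ⟨⟨⟨hφ, trivial⟩, trivial⟩, hφ⟩) h

theorem by_contra (hA : ∀ φ ∈ A, IsDFormula φ) (hΓ : ∀ φ ∈ Γ, IsDFormula φ) (hφ : IsDFormula φ)
    (h : Derives A (insert (neg φ) Γ) bot) : Derives A Γ φ :=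
  of_neg_neg hφ (deduction hA hΓ ⟨hφ, trivial⟩ h)

theorem ex_falso (hφ : IsDFormula φ) (h : Derives A Γ bot) : Derives A Γ φ :=
  of_neg_neg hφ (imp_intro_const ⟨hφ, trivial⟩ trivial h)

theorem imp_trans (hφ : IsDFormula φ) (hψ : IsDFormula ψ) (hχ : IsDFormula χ)
    (h1 : Derives A Γ (imp φ ψ)) (h2 : Derives A Γ (imp ψ χ)) : Derives A Γ (imp φ χ) :=
  .mp (.mp (.ax (.a1_s φ ψ χ) ⟨⟨hφ, hψ, hχ⟩, ⟨hφ, hψ⟩, hφ, hχ⟩)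
    (imp_intro_const hφ ⟨hψ, hχ⟩ h2)) h1

theorem of_alls {ys : List ℕ} (hφ : IsDFormula φ) (h : Derives A Γ (alls ys φ)) :
    Derives A Γ φ := by
  induction ys with
  | nil => exact h
  | cons y ys ih =>
    have hD := isDFormula_alls (ys := ys) hφ
    refine ih ?_
    have hax : IsAxiom (imp (all y (alls ys φ)) (subst1 y (Sum.inl y) (alls ys φ))) :=
      .a1_inst y _ _ (by rw [single_self]; exact freeFor_id _)
    rw [subst1_self] at hax
    exact .mp (.ax hax ⟨hD, hD⟩) h

theorem subst1_const {x : ℕ} (hφ : IsDFormula φ) (a : D) (h : Derives A Γ (all x φ)) :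
    Derives A Γ (subst1 x (Sum.inr a) φ) :=
  .mp (.ax (.a1_inst x _ _ (IsInstantiation.freeFor hφ (.single x a)))
    ⟨hφ, IsInstantiation.isDFormula_subst hφ (.single x a)⟩) h

/-- Instantiating a universal closure by domain constants. -/
theorem instAll {ys : List ℕ} (hys : ys.Nodup) (hfv : ∀ y, Sum.inl y ∈ fv φ → y ∈ ys)
    (hφ : IsDFormula φ) (a : ℕ → D) (h : Derives A Γ (alls ys φ)) :
    Derives A Γ (instAll a φ) := by
  -- Here `σ` is the instantiation performed so far, and `zs` lists the quantifiers still to be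
  -- removed.
  have key : ∀ zs : List ℕ, zs.Nodup → ∀ σ : Var D → Var D, IsInstantiation σ →
      (∀ n, Sum.inl n ∈ fv φ → n ∉ zs → σ (Sum.inl n) = Sum.inr (a n)) →
      (∀ n ∈ zs, σ (Sum.inl n) = Sum.inl n) →
      Derives A Γ (alls zs (subst σ φ)) → Derives A Γ (Fml.instAll a φ) := by
    intro zs
    induction zs with
    | nil =>
      intro _ σ hσ h1 _ h
      have : subst id (subst σ φ) = Fml.instAll a φ := by
        refine IsInstantiation.subst_subst hφ hσ fun v hv => ?_
        cases v with
        | inl n => simpa using h1 n hv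
        | inr d => simp [hσ.1 d]
      rw [subst_eq_self (σ := id) fun v _ => rfl] at this
      rw [← this]
      exact h
    | cons z zs ih =>
      intro hnd σ hσ h1 h2 h
      rw [List.nodup_cons] at hnd
      have h3 := subst1_const (isDFormula_alls (IsInstantiation.isDFormula_subst hφ hσ)) (a z) h
      rw [subst1_alls hnd.1] at h3
      have hτ : IsInstantiation (Function.update σ (Sum.inl z) (Sum.inr (a z))) := by
        refine ⟨fun d => by simp [hσ.1 d], fun n => ?_⟩
        by_cases hn : n = z
        · simp [hn]
        · rw [Function.update_of_ne (by simpa using hn)]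
          exact hσ.2 n
      refine ih hnd.2 _ hτ (fun n hn hz => ?_) (fun n hn => ?_) ?_
      · by_cases hnz : n = z
        · simp [hnz]
        · rw [Function.update_of_ne (by simpa using hnz)]
          exact h1 n hn (by simp [hnz, hz])
      · rw [Function.update_of_ne (by simpa using ne_of_mem_of_not_mem hn hnd.1)]
        exact h2 n (List.mem_cons_of_mem _ hn)
      · convert h3 using 2
        symm
        refine IsInstantiation.subst_subst hφ hσ fun v hv => ?_
        by_cases hv : v = Sum.inl z
        · subst hv
          rw [h2 z List.mem_cons_self]
          simp [single]
        · rw [Function.update_of_ne hv]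
          rcases hσ.eq_self_or v with h4 | ⟨d, h4⟩
          · rw [h4, single, Function.update_of_ne hv]
            rfl
          · simp [h4, single]
  refine key ys hys id ⟨fun _ => rfl, fun _ => Or.inl rfl⟩ (fun n hn h => absurd (hfv n hn) h)
    (fun _ _ => rfl) ?_
  rw [subst_eq_self (σ := id) fun v _ => rfl]
  exact h

/-- Iterates A3 one symbol at a time. Since the subscript contains the constants of `φ` from the
start, every intermediate axiom is a `D`-formula. -/
theorem box_enlarge {t : JTerm} {X Z : Finset (Var D)} (hXZ : X ⊆ Z) (hφ : IsDFormula φ)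
    (hX : consts φ ⊆ X) (h : Derives A Γ (box t X φ)) : Derives A Γ (box t Z φ) := by
  have key : ∀ Y : Finset (Var D), Derives A Γ (box t (Y ∪ X) φ) := by
    intro Y
    induction Y using Finset.induction_on with
    | empty => simpa using h
    | insert y Y _ ih =>
      rw [Finset.insert_union]
      by_cases hy : y ∈ Y ∪ X
      · rwa [Finset.insert_eq_self.2 hy]
      · have hc : consts φ ⊆ Y ∪ X := hX.trans Finset.subset_union_right
        exact .mp (.ax (.a3 t _ y φ hy)
          ⟨⟨hc, hφ⟩, hc.trans (Finset.subset_insert _ _), hφ⟩) ih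
  have := key Z
  rwa [Finset.union_eq_left.2 hXZ] at this

/-- Iterates A2, which may drop only symbols that are not free in `φ`. -/
theorem box_shrink {t : JTerm} {X Z : Finset (Var D)} (hXZ : X ⊆ Z) (hφ : IsDFormula φ)
    (hX : consts φ ⊆ X) (hfv : ∀ v ∈ Z, v ∈ fv φ → v ∈ X) (h : Derives A Γ (box t Z φ)) :
    Derives A Γ (box t X φ) := by
  have key : ∀ Y : Finset (Var D), Y ⊆ Z → Derives A Γ (box t (Y ∪ X) φ) →
      Derives A Γ (box t X φ) := by
    intro Y
    induction Y using Finset.induction_on with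
    | empty => simp
    | insert y Y _ ih =>
      intro hYZ h
      rw [Finset.insert_subset_iff] at hYZ
      refine ih hYZ.2 ?_
      rw [Finset.insert_union] at h
      by_cases hy : y ∈ Y ∪ X
      · rwa [Finset.insert_eq_self.2 hy] at h
      · have hc : consts φ ⊆ Y ∪ X := hX.trans Finset.subset_union_right
        refine .mp (.ax (.a2 t _ y φ hy fun hyf => hy ?_)
          ⟨⟨hc.trans (Finset.subset_insert _ _), hφ⟩, hc, hφ⟩) h
        exact Finset.mem_union_right _ (hfv y hYZ.1 hyf)
  exact key Z (Finset.Subset.refl _) (by rwa [Finset.union_eq_left.2 hXZ])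

end Derives

/-! ### The basic constant specification suffices -/

theorem IsConstantSpecification.isBasic {CS : Set (Fml D)} (hCS : IsConstantSpecification CS)
    {φ : Fml D} (h : φ ∈ CS) : IsBasic φ := by
  obtain ⟨i, ψ, _, hψ, rfl⟩ := hCS φ h
  simpa [IsBasic, consts] using hψ

theorem IsConstantSpecification.isDFormula {CS : Set (Fml D)} (hCS : IsConstantSpecification CS) :
    ∀ φ ∈ CS, IsDFormula φ := fun _ h => (hCS.isBasic h).isDFormula

theorem IsConstantSpecification.subset_extendCS {CS : Set (Fml D)}
    (hCS : IsConstantSpecification CS) : CS ⊆ extendCS CS := by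
  intro χ hχ
  obtain ⟨i, ψ, _, hψ, rfl⟩ := hCS χ hχ
  have h : subst id ψ = ψ := subst_eq_self fun v _ => rfl
  exact ⟨i, ψ, id, hχ, fun v _ => Or.inl rfl, Set.injOn_id _, h.symm ▸ hψ.isDFormula, by rw [h]⟩

/-- The empty subscript of a `D`-formula forces its body to be free of constants, so the
substitution moved no free symbol. -/
theorem mem_of_mem_extendCS {CS : Set (Fml D)} {χ : Fml D} (h : χ ∈ extendCS CS) (hχ : IsDFormula χ) :
    χ ∈ CS := by
  obtain ⟨i, φ, σ, hφ, hσ, _, _, rfl⟩ := h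
  have hc : consts (subst σ φ) = ∅ := Finset.subset_empty.1 hχ.1
  rwa [subst_eq_self]
  intro v hv
  rcases hσ v hv with h | ⟨a, h⟩
  · exact h
  · have := mem_consts_subst hv h
    simp [hc] at this

/-- The members of `CS(V)` that are not `D`-formulas are of no use in derivations. -/
theorem Derives.of_extendCS {CS Γ : Set (Fml D)} {φ : Fml D} (h : Derives (extendCS CS) Γ φ) (hΓ : ∀ φ ∈ Γ, IsDFormula φ) :
    (IsDFormula φ ∧ Derives CS Γ φ) ∨
      (¬ IsDFormula φ ∧
        ∃ (ys : List ℕ) (t : JTerm) (X : Finset (Var D)) (ψ : Fml D), φ = alls ys (box t X ψ)) := by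
  induction h with
  | ax h hD => exact Or.inl ⟨hD, .ax h hD⟩
  | @cs Γ φ h =>
    by_cases hD : IsDFormula φ
    · exact Or.inl ⟨hD, .cs (mem_of_mem_extendCS h hD)⟩
    · obtain ⟨i, ψ, σ, _, _, _, _, rfl⟩ := h
      exact Or.inr ⟨hD, [], _, _, _, rfl⟩
  | hyp h => exact Or.inl ⟨hΓ _ h, .hyp h⟩
  | mp h1 h2 ih1 ih2 =>
    -- A quantified box is not an implication, so it is no major premise; and as a minor premise it
    -- would make the antecedent of a `D`-formula fail to be one.
    rcases ih1 hΓ with ⟨hD1, hd1⟩ | ⟨_, ys, t, X, ψ, h⟩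
    · rcases ih2 hΓ with ⟨_, hd2⟩ | h
      · exact Or.inl ⟨hD1.2, .mp hd1 hd2⟩
      · exact absurd hD1.1 h.1
    · cases ys <;> simp [alls] at h
  | gen x hx h ih =>
    rcases ih hΓ with ⟨hD, hd⟩ | ⟨hD, ys, t, X, ψ, rfl⟩
    · exact Or.inl ⟨hD, .gen x hx hd⟩
    · exact Or.inr ⟨hD, x :: ys, t, X, ψ, rfl⟩
  | weaken hs h ih =>
    rcases ih fun φ hφ => hΓ φ (hs hφ) with ⟨hD, hd⟩ | h
    · exact Or.inl ⟨hD, .weaken hs hd⟩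
    · exact Or.inr h

theorem IsConstantSpecification.consistent_extendCS_iff {CS Γ : Set (Fml D)}
    (hCS : IsConstantSpecification CS) (hΓ : ∀ φ ∈ Γ, IsDFormula φ) :
    Consistent (extendCS CS) Γ ↔ Consistent CS Γ := by
  refine not_congr ⟨fun h => ?_, fun h => h.mono_axioms hCS.subset_extendCS⟩
  rcases h.of_extendCS hΓ with h | h
  · exact h.2
  · exact absurd trivial h.1

theorem IsConstantSpecification.maxConsistent_extendCS_iff {CS Γ : Set (Fml D)}
    (hCS : IsConstantSpecification CS) :
    MaxConsistent (extendCS CS) Γ ↔ MaxConsistent CS Γ := by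
  refine and_congr_right fun hΓ => and_congr (hCS.consistent_extendCS_iff hΓ) ?_
  refine forall_congr' fun Δ => forall_congr' fun hΔ => ?_
  rw [hCS.consistent_extendCS_iff hΔ]

/-! ### Internalization -/

section Internalization

variable {CS : Set (Fml D)}

/-- Every axiom among the `D`-formulas is justified by a constant. -/
theorem exists_const_box (happ : AxiomaticallyAppropriate CS) {ψ : Fml D} (hψ : IsAxiom ψ)
    (hD : IsDFormula ψ) :
    ∃ i : ℕ, Derives CS ∅ (box (JTerm.const i) (consts ψ) ψ) := by
  induction hn : (consts ψ).card generalizing ψ with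
  | zero =>
    rw [Finset.card_eq_zero] at hn
    obtain ⟨i, hi⟩ := happ ψ hψ hn
    exact ⟨i, by rw [hn]; exact .cs hi⟩
  | succ n ih =>
    obtain ⟨v, hv⟩ : (consts ψ).Nonempty := by
      rw [← Finset.card_pos]
      omega
    obtain ⟨a, rfl⟩ := exists_inr_of_mem_consts hv
    -- One constant is traded for a fresh `y`, to which the induction hypothesis applies. With `y`
    -- added to the subscript by A3, generalizing over `y` and instantiating by `a` restores `ψ`
    -- with `a` in the subscript.
    obtain ⟨y, hax, hy⟩ := ((hψ.rep a).and (eventually_inl_notMem (vars ψ))).exists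
    have hD' := isDFormula_rep a y hD
    obtain ⟨i, hi⟩ := ih hax hD' (by rw [consts_rep, Finset.card_erase_of_mem hv]; omega)
    refine ⟨i, ?_⟩
    have himg : (consts ψ).image (repMap a y) = insert (Sum.inl y) (consts (rep a y ψ)) := by
      rw [consts_rep]
      nth_rewrite 1 [← Finset.insert_erase hv]
      rw [Finset.image_insert, repMap_self]
      congr 1
      refine (Finset.image_congr (g := id) fun w hw => ?_).trans Finset.image_id
      exact repMap_of_ne y (Finset.mem_erase.1 hw).1
    have h1 : Derives CS ∅ (rep a y (box (JTerm.const i) (consts ψ) ψ)) := by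
      rw [rep, himg]
      exact hi.box_enlarge (Finset.subset_insert _ _) hD' (Finset.Subset.refl _)
    have hDbox := isDFormula_box_self (JTerm.const i) hD
    have h2 := (Derives.gen y (by simp) h1).subst1_const (isDFormula_rep a y hDbox) a
    rwa [subst1_rep hDbox] at h2
    simp only [vars, Finset.mem_union, not_or]
    exact ⟨inl_notMem_consts _ _, hy⟩

/-- `φ` is justified by a term relative to `Γ`. -/
def Justified (CS Γ : Set (Fml D)) (φ : Fml D) : Prop :=
  ∃ t : JTerm, Derives CS Γ (box t (consts φ) φ)

/-- B2 needs equal subscripts, so that of `φ` is enlarged first. Afterwards A2 removes the constants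
of `φ` that are absent from `ψ`. -/
theorem Justified.mp {Γ : Set (Fml D)} {φ ψ : Fml D} (hD : IsDFormula (imp φ ψ))
    (h1 : Justified CS Γ (imp φ ψ)) (h2 : Justified CS Γ φ) : Justified CS Γ ψ := by
  obtain ⟨t, ht⟩ := h1
  obtain ⟨s, hs⟩ := h2
  refine ⟨JTerm.app t s, ?_⟩
  have h3 : Derives CS Γ (box s (consts (imp φ ψ)) φ) :=
    hs.box_enlarge Finset.subset_union_left hD.1 (Finset.Subset.refl _)
  have hφ : consts φ ⊆ consts (imp φ ψ) := Finset.subset_union_left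
  have hψ : consts ψ ⊆ consts (imp φ ψ) := Finset.subset_union_right
  refine (Derives.mp (.mp (.ax (.b2 t s _ φ ψ)
    ⟨⟨Finset.Subset.refl _, hD⟩, ⟨hφ, hD.1⟩, hψ, hD.2⟩) ht) h3).box_shrink hψ hD.2
    (Finset.Subset.refl _) ?_
  intro v hv hvf
  obtain ⟨d, rfl⟩ := exists_inr_of_mem_consts hv
  exact inr_mem_consts_of_mem_fv hvf

/-- B5 always applies, since the subscript consists of constants only. -/
theorem Justified.all {Γ : Set (Fml D)} {φ : Fml D} (hD : IsDFormula φ) (x : ℕ)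
    (h : Justified CS Γ φ) : Justified CS Γ (all x φ) := by
  obtain ⟨t, ht⟩ := h
  exact ⟨JTerm.gen x t, .mp (.ax (.b5 t _ x φ (inl_notMem_consts _ _))
    ⟨⟨Finset.Subset.refl _, hD⟩, Finset.Subset.refl _, hD⟩) ht⟩

theorem Justified.alls {Γ : Set (Fml D)} {φ : Fml D} (hD : IsDFormula φ) (ys : List ℕ)
    (h : Justified CS Γ φ) : Justified CS Γ (alls ys φ) := by
  induction ys with
  | nil => exact h
  | cons y ys ih => exact ih.all (isDFormula_alls hD) y

/-- The term copies the derivation: constants for axioms, `!c` for a member `c : ψ` of `CS`,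
application for modus ponens, `gen` for generalization. -/
theorem internalization (hCS : IsConstantSpecification CS) (happ : AxiomaticallyAppropriate CS)
    {φ : Fml D} (h : Derives CS ∅ φ) : Justified CS ∅ φ := by
  have hempty : ∀ φ ∈ (∅ : Set (Fml D)), IsDFormula φ := by simp
  generalize hΓ : (∅ : Set (Fml D)) = Γ at h
  induction h with
  | ax h hD =>
    subst hΓ
    obtain ⟨i, hi⟩ := exists_const_box happ h hD
    exact ⟨_, hi⟩
  | @cs Γ φ h =>
    subst hΓ
    have hD := hCS.isDFormula φ h
    have hb := hCS.isBasic h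
    obtain ⟨i, ψ, _, hψ, rfl⟩ := hCS φ h
    refine ⟨JTerm.bang (JTerm.const i), ?_⟩
    have h1 : consts (box (JTerm.const i) ∅ ψ) = ∅ := hb
    rw [h1]
    exact .mp (.ax (.b4 _ _ _) ⟨hD, by rw [h1], hD⟩) (.cs h)
  | hyp h => subst hΓ; simp at h
  | mp h1 h2 ih1 ih2 =>
    subst hΓ
    exact (ih1 rfl).mp (h1.isDFormula hCS.isDFormula hempty) (ih2 rfl)
  | gen x hx h ih =>
    subst hΓ
    exact (ih rfl).all (h.isDFormula hCS.isDFormula hempty) x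
  | weaken hs h ih =>
    subst hΓ
    obtain rfl := Set.subset_empty_iff.1 hs
    exact ih rfl

end Internalization

/-! ### Maximally consistent sets -/

namespace MaxConsistent

variable {A Γ : Set (Fml D)} {φ ψ : Fml D}

theorem not_mem_iff_neg_mem (hA : ∀ φ ∈ A, IsDFormula φ) (h : MaxConsistent A Γ)
    (hφ : IsDFormula φ) : φ ∉ Γ ↔ neg φ ∈ Γ := by
  constructor
  · intro hn
    have hD : ∀ ψ ∈ insert φ Γ, IsDFormula ψ := by
      rintro ψ (rfl | hψ)
      · exact hφ
      · exact h.1 ψ hψ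
    have h1 : Derives A (insert φ Γ) bot := by
      by_contra hc
      exact hn (h.2.2 _ hD (Set.subset_insert _ _) hc ▸ Set.mem_insert _ _)
    have h2 : Derives A Γ (neg φ) := h1.deduction hA h.1 hφ
    by_contra hc
    have hD' : ∀ ψ ∈ insert (neg φ) Γ, IsDFormula ψ := by
      rintro ψ (rfl | hψ)
      · exact ⟨hφ, trivial⟩
      · exact h.1 ψ hψ
    refine hc (h.2.2 _ hD' (Set.subset_insert _ _) ?_ ▸ Set.mem_insert _ _)
    exact fun hb => h.2.1 (.mp (hb.deduction hA h.1 (φ := neg φ) ⟨hφ, trivial⟩) h2)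
  · exact fun h1 h2 => h.2.1 (.mp (.hyp h1) (.hyp h2))

theorem mem_of_derives (hA : ∀ φ ∈ A, IsDFormula φ) (h : MaxConsistent A Γ)
    (hd : Derives A Γ φ) : φ ∈ Γ := by
  by_contra hn
  rw [h.not_mem_iff_neg_mem hA (hd.isDFormula hA h.1)] at hn
  exact h.2.1 (.mp (.hyp hn) hd)

theorem imp_mem_iff (hA : ∀ φ ∈ A, IsDFormula φ) (h : MaxConsistent A Γ) (hφ : IsDFormula φ)
    (hψ : IsDFormula ψ) : imp φ ψ ∈ Γ ↔ (φ ∈ Γ → ψ ∈ Γ) := by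
  refine ⟨fun h1 h2 => h.mem_of_derives hA (.mp (.hyp h1) (.hyp h2)), fun h1 => ?_⟩
  by_cases h2 : φ ∈ Γ
  · exact h.mem_of_derives hA (.imp_intro_const hφ hψ (.hyp (h1 h2)))
  · rw [h.not_mem_iff_neg_mem hA hφ] at h2
    exact h.mem_of_derives hA (.imp_trans (ψ := bot) hφ trivial hψ (.hyp h2)
      (.deduction hA h.1 trivial (.ex_falso hψ (.hyp (Set.mem_insert _ _)))))

/-- Lindenbaum's lemma: derivations use finitely many hypotheses, so being a consistent set of
`D`-formulas is a property of finite character. -/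
theorem exists_superset (hΓ : ∀ φ ∈ Γ, IsDFormula φ)
    (hc : Consistent A Γ) : ∃ Δ, Γ ⊆ Δ ∧ MaxConsistent A Δ := by
  obtain ⟨Δ, hΔ, hmax⟩ := Order.IsOfFiniteCharacter.exists_maximal
    (F := {Δ : Set (Fml D) | (∀ φ ∈ Δ, IsDFormula φ) ∧ Consistent A Δ}) (x := Γ) (by
      intro Δ
      constructor
      · rintro ⟨h1, h2⟩ Θ hs _
        exact ⟨fun φ hφ => h1 φ (hs hφ), fun h => h2 (h.weaken hs)⟩
      · intro h
        refine ⟨fun φ hφ => (h {φ} (by simpa using hφ) (Set.finite_singleton _)).1 φ rfl, ?_⟩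
        intro hb
        obtain ⟨Θ, hs, hf, hd⟩ := hb.exists_finite
        exact (h Θ hs hf).2 hd) ⟨hΓ, hc⟩
  refine ⟨Δ, hΔ, hmax.prop.1, hmax.prop.2, fun Θ h1 h2 h3 => ?_⟩
  exact (hmax.eq_of_subset ⟨h1, h3⟩ h2).symm

end MaxConsistent

/-! ### Consequences of `Γ^#` -/

theorem isDFormula_sharp (Γ : Set (Fml D)) : ∀ φ ∈ sharp Γ, IsDFormula φ := by
  rintro _ ⟨t, φ, ys, hφ, _, _, _, rfl⟩
  exact isDFormula_alls hφ

/-- What follows from `Γ^#` is justified in `Γ`. -/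
theorem justified_of_derives_sharp {CS Γ : Set (Fml D)} (hCS : IsConstantSpecification CS)
    (happ : AxiomaticallyAppropriate CS) {ψ : Fml D} (h : Derives CS (sharp Γ) ψ) :
    Justified CS Γ ψ := by
  obtain ⟨L, hL, hd⟩ := Derives.exists_foldr (Γ := ∅) hCS.isDFormula (by simp)
    (isDFormula_sharp Γ) (by simpa using h)
  have hD := hd.isDFormula hCS.isDFormula (by simp)
  obtain ⟨t, ht⟩ := internalization hCS happ hd
  have hJ : Justified CS Γ (L.foldr imp ψ) := ⟨t, ht.of_empty⟩
  clear hd ht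
  induction L with
  | nil => exact hJ
  | cons χ L ih =>
    refine ih (fun φ hφ => hL φ (List.mem_cons_of_mem _ hφ)) hD.2 (hJ.mp hD ?_)
    obtain ⟨s, φ, ys, hφ, hmem, _, _, rfl⟩ := hL χ List.mem_cons_self
    exact Justified.alls hφ ys ⟨s, .hyp hmem⟩

theorem exists_alls_mem_sharp {Γ : Set (Fml D)} {t : JTerm} {φ : Fml D} (hφ : IsDFormula φ)
    (h : box t (consts φ) φ ∈ Γ) :
    ∃ ys : List ℕ, ys.Nodup ∧ (∀ y, Sum.inl y ∈ fv φ → y ∈ ys) ∧ alls ys φ ∈ sharp Γ := by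
  obtain ⟨ys, hnd, hys⟩ : ∃ ys : List ℕ, ys.Nodup ∧ ∀ y : ℕ, y ∈ ys ↔ Sum.inl y ∈ fv φ := by
    have hf : {y : ℕ | Sum.inl y ∈ fv φ}.Finite :=
      (fv φ).finite_toSet.preimage Sum.inl_injective.injOn
    exact ⟨hf.toFinset.toList, Finset.nodup_toList _, by simp⟩
  exact ⟨ys, hnd, fun y => (hys y).2, t, φ, ys, hφ, h, hnd, hys, rfl⟩

/-! ### Templates and their instantiation sets -/

namespace Template

/-- Renaming the letters of a template by adding `k` to their indices. -/
def shift (k : ℕ) : Template → Template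
  | letter i => letter (i + k)
  | neg F => neg (shift k F)
  | or F G => or (shift k F) (shift k G)
  | and F G => and (shift k F) (shift k G)
  | box F => box (shift k F)

theorem letters_shift (k : ℕ) (F : Template) : letters (shift k F) = (letters F).map (· + k) := by
  induction F with
  | letter i => rfl
  | neg F ih => exact ih
  | or F G ih1 ih2 => simp [shift, letters, ih1, ih2]
  | and F G ih1 ih2 => simp [shift, letters, ih1, ih2]
  | box F ih => exact ih

theorem onlyOr_shift (k : ℕ) {F : Template} (h : OnlyOr F) : OnlyOr (shift k F) := by
  induction F with
  | letter i => trivial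
  | neg F ih => exact h
  | or F G ih1 ih2 => exact ⟨ih1 h.1, ih2 h.2⟩
  | and F G ih1 ih2 => exact h
  | box F ih => exact ih h

theorem inst_shift (f : ℕ → Fml D) (k : ℕ) (F : Template) :
    inst f (shift k F) = inst (fun i => f (i + k)) F := by
  induction F with
  | letter i => rfl
  | neg F ih => simp only [shift, inst, ih]
  | or F G ih1 ih2 => simp only [shift, inst, ih1, ih2]
  | and F G ih1 ih2 => simp only [shift, inst, ih1, ih2]
  | box F ih => simp only [shift, inst, ih]

theorem inst_congr {f g : ℕ → Fml D} {F : Template} (h : ∀ i ∈ letters F, f i = g i) :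
    inst f F = inst g F := by
  induction F with
  | letter i => simp [inst, h i (by simp [letters])]
  | neg F ih => simp only [inst, ih h]
  | or F G ih1 ih2 =>
    simp only [letters, List.mem_append] at h
    simp only [inst, ih1 fun i hi => h i (Or.inl hi), ih2 fun i hi => h i (Or.inr hi)]
  | and F G ih1 ih2 =>
    simp only [letters, List.mem_append] at h
    simp only [inst, ih1 fun i hi => h i (Or.inl hi), ih2 fun i hi => h i (Or.inr hi)]
  | box F ih => simp only [inst, ih h]

theorem isDFormula_of_mem_inst {f : ℕ → Fml D} (hf : ∀ i, IsDFormula (f i)) {F : Template} :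
    ∀ ψ ∈ inst f F, IsDFormula ψ := by
  induction F with
  | letter i => rintro ψ rfl; exact hf i
  | neg F ih => rintro _ ⟨ψ, hψ, rfl⟩; exact ⟨ih ψ hψ, trivial⟩
  | or F G ih1 ih2 =>
    rintro _ ⟨ψ, hψ, θ, hθ, rfl⟩
    exact ⟨⟨ih1 ψ hψ, trivial⟩, ih2 θ hθ⟩
  | and F G ih1 ih2 =>
    rintro _ ⟨ψ, hψ, θ, hθ, rfl⟩
    exact ⟨⟨ih1 ψ hψ, ih2 θ hθ, trivial⟩, trivial⟩
  | box F ih => rintro _ ⟨ψ, hψ, t, rfl⟩; exact isDFormula_box_self t (ih ψ hψ)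

theorem inst_nonempty (f : ℕ → Fml D) (F : Template) : (inst f F).Nonempty := by
  induction F with
  | letter i => exact Set.singleton_nonempty _
  | neg F ih => obtain ⟨ψ, hψ⟩ := ih; exact ⟨_, ψ, hψ, rfl⟩
  | or F G ih1 ih2 =>
    obtain ⟨ψ, hψ⟩ := ih1
    obtain ⟨θ, hθ⟩ := ih2
    exact ⟨_, ψ, hψ, θ, hθ, rfl⟩
  | and F G ih1 ih2 =>
    obtain ⟨ψ, hψ⟩ := ih1
    obtain ⟨θ, hθ⟩ := ih2
    exact ⟨_, ψ, hψ, θ, hθ, rfl⟩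
  | box F ih => obtain ⟨ψ, hψ⟩ := ih; exact ⟨_, ψ, hψ, JTerm.const 0, rfl⟩

/-- All members of an instantiation set have the same constants. -/
theorem consts_eq_of_mem_inst {f : ℕ → Fml D} {F : Template} :
    ∀ {ψ θ : Fml D}, ψ ∈ inst f F → θ ∈ inst f F → consts ψ = consts θ := by
  induction F with
  | letter i => rintro ψ θ rfl rfl; rfl
  | neg F ih =>
    rintro _ _ ⟨ψ, hψ, rfl⟩ ⟨θ, hθ, rfl⟩
    simp only [Fml.neg, consts, ih hψ hθ]
  | or F G ih1 ih2 =>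
    rintro _ _ ⟨ψ, hψ, ψ', hψ', rfl⟩ ⟨θ, hθ, θ', hθ', rfl⟩
    simp only [Fml.or, Fml.neg, consts, ih1 hψ hθ, ih2 hψ' hθ']
  | and F G ih1 ih2 =>
    rintro _ _ ⟨ψ, hψ, ψ', hψ', rfl⟩ ⟨θ, hθ, θ', hθ', rfl⟩
    simp only [Fml.and, Fml.neg, consts, ih1 hψ hθ, ih2 hψ' hθ']
  | box F ih =>
    rintro _ _ ⟨ψ, hψ, t, rfl⟩ ⟨θ, hθ, s, rfl⟩
    rw [consts_box_self, consts_box_self, ih hψ hθ]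

end Template

open Template

/-! ### Monotonicity of disjunction and of justification -/

namespace Derives

variable {A Γ : Set (Fml D)} {φ ψ φ' ψ' : Fml D}

theorem or_mono (hA : ∀ φ ∈ A, IsDFormula φ) (hφ : IsDFormula φ) (hφ' : IsDFormula φ')
    (hψ : IsDFormula ψ) (h1 : Derives A ∅ (imp φ φ'))
    (h2 : Derives A ∅ (imp ψ ψ')) :
    Derives A ∅ (imp (Fml.or φ ψ) (Fml.or φ' ψ')) := by
  have hor : IsDFormula (Fml.or φ ψ) := ⟨⟨hφ, trivial⟩, hψ⟩
  have hn : IsDFormula (neg φ') := ⟨hφ', trivial⟩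
  have hn2 : ∀ χ ∈ insert (neg φ') (insert (Fml.or φ ψ) (∅ : Set (Fml D))), IsDFormula χ := by
    simpa using ⟨hn, hor⟩
  have hn1 : ∀ χ ∈ insert (Fml.or φ ψ) (∅ : Set (Fml D)), IsDFormula χ := by simpa using hor
  refine deduction hA (by simp) hor (deduction hA hn1 hn ?_)
  refine .mp h2.of_empty (.mp (φ := neg φ) (.hyp (.inr (.inl rfl))) (deduction hA hn2 hφ ?_))
  exact .mp (φ := φ') (.hyp (.inr (.inl rfl))) (.mp h1.of_empty (.hyp (.inl rfl)))

theorem or_inl (hA : ∀ φ ∈ A, IsDFormula φ) (hφ : IsDFormula φ) (hψ : IsDFormula ψ) :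
    Derives A ∅ (imp φ (Fml.or φ ψ)) := by
  have hn : IsDFormula (neg φ) := ⟨hφ, trivial⟩
  refine deduction hA (by simp) hφ (deduction hA (by simpa using hφ) hn ?_)
  exact ex_falso hψ (.mp (φ := φ) (.hyp (Set.mem_insert _ _)) (.hyp (by simp)))

theorem or_inr (hφ : IsDFormula φ) (hψ : IsDFormula ψ) :
    Derives A ∅ (imp ψ (Fml.or φ ψ)) :=
  .ax (.a1_k ψ (neg φ)) ⟨hψ, ⟨hφ, trivial⟩, hψ⟩

/-- If `φ → ψ` is derivable then `t :_X φ → s :_X ψ` is, for some `s`. -/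
theorem exists_box_imp (hA : IsConstantSpecification A) (happ : AxiomaticallyAppropriate A)
    (hφ : IsDFormula φ) (hψ : IsDFormula ψ) (hc : consts φ = consts ψ)
    (h : Derives A ∅ (imp φ ψ)) (t : JTerm) :
    ∃ s : JTerm, Derives A ∅ (imp (box t (consts φ) φ) (box s (consts ψ) ψ)) := by
  obtain ⟨r, hr⟩ := internalization hA happ h
  have h1 : consts (imp φ ψ) = consts ψ := by rw [consts, hc, Finset.union_self]
  rw [h1] at hr
  rw [hc]
  have hs : consts φ ⊆ consts ψ := hc.subset
  have hs' : consts (imp φ ψ) ⊆ consts ψ := h1.subset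
  exact ⟨JTerm.app r t, .mp (.ax (.b2 r t _ φ ψ)
    ⟨⟨hs', hφ, hψ⟩, ⟨hs, hφ⟩, Finset.Subset.refl _, hψ⟩) hr⟩

end Derives

/-! ### Consistency with negated instances -/

section Instances

variable {CS : Set (Fml D)}

/-- Two instances of a disjunctive template imply a common third one. -/
theorem exists_common_instance (hCS : IsConstantSpecification CS)
    (happ : AxiomaticallyAppropriate CS) {f : ℕ → Fml D} (hf : ∀ i, IsDFormula (f i))
    {F : Template} (hF : OnlyOr F) :
    ∀ {ψ₁ ψ₂ : Fml D}, ψ₁ ∈ inst f F → ψ₂ ∈ inst f F →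
      ∃ ψ ∈ inst f F, Derives CS ∅ (imp ψ₁ ψ) ∧ Derives CS ∅ (imp ψ₂ ψ) := by
  have hA := hCS.isDFormula
  induction F with
  | letter i =>
    rintro ψ₁ ψ₂ rfl rfl
    exact ⟨_, rfl, .imp_self (hf i), .imp_self (hf i)⟩
  | neg F ih => exact hF.elim
  | and F G ih1 ih2 => exact hF.elim
  | or F G ih1 ih2 =>
    rintro _ _ ⟨ψ₁, hψ₁, θ₁, hθ₁, rfl⟩ ⟨ψ₂, hψ₂, θ₂, hθ₂, rfl⟩
    obtain ⟨ψ, hψ, h1, h2⟩ := ih1 hF.1 hψ₁ hψ₂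
    obtain ⟨θ, hθ, h3, h4⟩ := ih2 hF.2 hθ₁ hθ₂
    have d1 := isDFormula_of_mem_inst hf (F := F)
    have d2 := isDFormula_of_mem_inst hf (F := G)
    exact ⟨_, ⟨ψ, hψ, θ, hθ, rfl⟩,
      .or_mono hA (d1 _ hψ₁) (d1 _ hψ) (d2 _ hθ₁) h1 h3,
      .or_mono hA (d1 _ hψ₂) (d1 _ hψ) (d2 _ hθ₂) h2 h4⟩
  | box F ih =>
    rintro _ _ ⟨ψ₁, hψ₁, t₁, rfl⟩ ⟨ψ₂, hψ₂, t₂, rfl⟩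
    obtain ⟨ψ, hψ, h1, h2⟩ := ih hF hψ₁ hψ₂
    have d := isDFormula_of_mem_inst hf (F := F)
    -- Internalizing both implications gives terms `s₁`, `s₂` for the same `ψ`; B3 makes their sum
    -- serve both.
    obtain ⟨s₁, hs₁⟩ := Derives.exists_box_imp hCS happ (d _ hψ₁) (d _ hψ)
      (consts_eq_of_mem_inst hψ₁ hψ) h1 t₁
    obtain ⟨s₂, hs₂⟩ := Derives.exists_box_imp hCS happ (d _ hψ₂) (d _ hψ)
      (consts_eq_of_mem_inst hψ₂ hψ) h2 t₂
    have b : ∀ t, IsDFormula (Fml.box t (consts ψ) ψ) := fun t => isDFormula_box_self t (d _ hψ)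
    exact ⟨_, ⟨ψ, hψ, JTerm.plus s₁ s₂, rfl⟩,
      .imp_trans (isDFormula_box_self _ (d _ hψ₁)) (b _) (b _) hs₁
        (.ax (.b3_left s₁ s₂ _ _) ⟨b _, b _⟩),
      .imp_trans (isDFormula_box_self _ (d _ hψ₂)) (b _) (b _) hs₂
        (.ax (.b3_right s₁ s₂ _ _) ⟨b _, b _⟩)⟩

/-- A set is inconsistent with the negated instances of a disjunctive template just in case it
proves one of the instances. -/
theorem consistent_union_neg_inst_iff (hCS : IsConstantSpecification CS)
    (happ : AxiomaticallyAppropriate CS) {f : ℕ → Fml D} (hf : ∀ i, IsDFormula (f i))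
    {F : Template} (hF : OnlyOr F) {Γ : Set (Fml D)} (hΓ : ∀ φ ∈ Γ, IsDFormula φ) :
    Consistent CS (Γ ∪ inst f (neg F)) ↔ ∀ ψ ∈ inst f F, ¬ Derives CS Γ ψ := by
  have hA := hCS.isDFormula
  have d := isDFormula_of_mem_inst hf (F := F)
  constructor
  · intro hc ψ hψ h
    exact hc (.mp (.hyp (Or.inr ⟨ψ, hψ, rfl⟩)) (h.weaken Set.subset_union_left))
  · intro hno hb
    obtain ⟨L, hL, hd⟩ := hb.exists_foldr hA hΓ (isDFormula_of_mem_inst hf)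
    -- The negated instances in `L` collapse to a single one: if `ψ₁` and `ψ₂` both imply `ψ`, then
    -- `¬ψ` yields `¬ψ₁` and `¬ψ₂`. For empty `L` any instance will do.
    have key : ∀ Γ : Set (Fml D), (∀ φ ∈ Γ, IsDFormula φ) → Derives CS Γ (L.foldr imp bot) →
        ∃ ψ ∈ inst f F, Derives CS (insert (Fml.neg ψ) Γ) bot := by
      clear hd
      induction L with
      | nil =>
        intro Γ hΓ hd
        obtain ⟨ψ, hψ⟩ := inst_nonempty f F
        exact ⟨ψ, hψ, hd.weaken (Set.subset_insert _ _)⟩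
      | cons χ L ih =>
        intro Γ hΓ hd
        obtain ⟨ψ₁, hψ₁, rfl⟩ := hL χ List.mem_cons_self
        have hn : ∀ {ψ}, ψ ∈ inst f F → IsDFormula (Fml.neg ψ) := fun h => ⟨d _ h, trivial⟩
        have hΓ₁ : ∀ φ ∈ insert (Fml.neg ψ₁) Γ, IsDFormula φ := by
          rintro φ (rfl | h)
          · exact hn hψ₁
          · exact hΓ φ h
        obtain ⟨ψ₂, hψ₂, h2⟩ := ih (fun φ hφ => hL φ (List.mem_cons_of_mem _ hφ)) _ hΓ₁
          (.mp (hd.weaken (Set.subset_insert _ _)) (.hyp (Set.mem_insert _ _)))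
        obtain ⟨ψ, hψ, h3, h4⟩ := exists_common_instance hCS happ hf hF hψ₁ hψ₂
        refine ⟨ψ, hψ, h2.cut hA ?_ ?_⟩
        · rintro φ (rfl | h)
          · exact hn hψ₂
          · exact hΓ₁ φ h
        · have hc : ∀ {θ}, θ ∈ inst f F → Derives CS ∅ (imp θ ψ) →
              Derives CS (insert (Fml.neg ψ) Γ) (Fml.neg θ) := fun hθ h =>
            .imp_trans (d _ hθ) (d _ hψ) (show IsDFormula bot from trivial) h.of_empty
              (.hyp (Set.mem_insert _ _))
          rintro φ (rfl | rfl | h)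
          · exact hc hψ₂ h4
          · exact hc hψ₁ h3
          · exact .hyp (Set.mem_insert_of_mem _ h)
    obtain ⟨ψ, hψ, h⟩ := key Γ hΓ hd
    exact hno ψ hψ (h.by_contra hA hΓ (d _ hψ))

theorem isDFormula_update {f : ℕ → Fml D} (hf : ∀ i, IsDFormula (f i)) (q : ℕ) {χ : Fml D}
    (hχ : IsDFormula χ) : ∀ i, IsDFormula (Function.update f q χ i) := by
  intro i
  by_cases h : i = q
  · subst h; simpa using hχ
  · rw [Function.update_of_ne h]; exact hf i

theorem isDFormula_subst1 {φ : Fml D} (h : IsDFormula φ) (x : ℕ) (a : D) :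
    IsDFormula (subst1 x (Sum.inr a) φ) :=
  IsInstantiation.isDFormula_subst h (.single x a)

theorem IsConstantSpecification.admitsInstantiation_extendCS_iff
    (hCS : IsConstantSpecification CS) {Γ : Set (Fml D)} (hΓ : ∀ φ ∈ Γ, IsDFormula φ) :
    AdmitsInstantiation (extendCS CS) Γ ↔ AdmitsInstantiation CS Γ := by
  have key : ∀ (g : ℕ → Fml D) (F : Template), (∀ i, IsDFormula (g i)) →
      (Consistent (extendCS CS) (Γ ∪ inst g F) ↔ Consistent CS (Γ ∪ inst g F)) := by
    intro g F hg
    refine hCS.consistent_extendCS_iff ?_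
    rintro φ (h | h)
    · exact hΓ φ h
    · exact isDFormula_of_mem_inst hg φ h
  unfold AdmitsInstantiation
  refine forall_congr' fun F => forall_congr' fun q => forall_congr' fun f => forall_congr' fun x =>
    forall_congr' fun φ => forall_congr' fun _ => forall_congr' fun hf => forall_congr' fun hφ => ?_
  rw [key _ _ (isDFormula_update hf q (χ := all x φ) hφ)]
  refine imp_congr_right fun _ => exists_congr fun a => ?_
  rw [key _ _ (isDFormula_update hf q (isDFormula_subst1 hφ x a))]

/-- If a maximally consistent set `Γ` admits instantiation, so does `Γ^#`. -/
theorem admitsInstantiation_sharp (hCS : IsConstantSpecification CS)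
    (happ : AxiomaticallyAppropriate CS) {Γ : Set (Fml D)} (hΓ : MaxConsistent CS Γ)
    (hai : AdmitsInstantiation CS Γ) : AdmitsInstantiation CS (sharp Γ) := by
  -- `Γ^#` proves an instance `ψ` of `F` exactly when `Γ` proves an instance `t : ψ` of `□F`, so
  -- admission for `□F` over `Γ` gives it for `F` over `Γ^#`.
  have key : ∀ (g : ℕ → Fml D) (F : Template), OnlyOr F → (∀ i, IsDFormula (g i)) →
      (Consistent CS (sharp Γ ∪ inst g (neg F)) ↔
        Consistent CS (Γ ∪ inst g (neg (.box F)))) := by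
    intro g F hF hg
    rw [consistent_union_neg_inst_iff hCS happ hg hF (isDFormula_sharp Γ),
      consistent_union_neg_inst_iff hCS happ hg (F := .box F) hF hΓ.1]
    constructor
    · rintro h _ ⟨ψ, hψ, t, rfl⟩ hd
      have hD := isDFormula_of_mem_inst hg ψ hψ
      obtain ⟨ys, _, _, hmem⟩ := exists_alls_mem_sharp hD (hΓ.mem_of_derives hCS.isDFormula hd)
      exact h ψ hψ (.of_alls hD (.hyp hmem))
    · intro h ψ hψ hd
      obtain ⟨t, ht⟩ := justified_of_derives_sharp hCS happ hd
      exact h _ ⟨ψ, hψ, t, rfl⟩ ht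
  intro F q f x φ hF hf hφ hc
  rw [key _ _ hF.2 (isDFormula_update hf q (χ := all x φ) hφ)] at hc
  obtain ⟨a, ha⟩ := hai (.box F) q f x φ hF hf hφ hc
  exact ⟨a, (key _ _ hF.2 (isDFormula_update hf q (isDFormula_subst1 hφ x a))).2 ha⟩

end Instances

/-! ### Countability -/

/-- An injective numbering of terms. -/
def JTerm.code : JTerm → ℕ
  | jvar i => Nat.pair 0 i
  | const i => Nat.pair 1 i
  | app t s => Nat.pair 2 (Nat.pair t.code s.code)
  | plus t s => Nat.pair 3 (Nat.pair t.code s.code)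
  | bang t => Nat.pair 4 t.code
  | barcan t => Nat.pair 5 t.code
  | gen x t => Nat.pair 6 (Nat.pair x t.code)

theorem JTerm.code_injective : Function.Injective JTerm.code := by
  intro t
  induction t with
  | jvar i => intro s h; cases s <;> simp_all [code, Nat.pair_eq_pair]
  | const i => intro s h; cases s <;> simp_all [code, Nat.pair_eq_pair]
  | app t s ih1 ih2 =>
    intro r h
    cases r <;> simp only [code, Nat.pair_eq_pair] at h <;> try omega
    rw [ih1 h.2.1, ih2 h.2.2]
  | plus t s ih1 ih2 =>
    intro r h
    cases r <;> simp only [code, Nat.pair_eq_pair] at h <;> try omega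
    rw [ih1 h.2.1, ih2 h.2.2]
  | bang t ih =>
    intro r h
    cases r <;> simp only [code, Nat.pair_eq_pair] at h <;> try omega
    rw [ih h.2]
  | barcan t ih =>
    intro r h
    cases r <;> simp only [code, Nat.pair_eq_pair] at h <;> try omega
    rw [ih h.2]
  | gen x t ih =>
    intro r h
    cases r <;> simp only [code, Nat.pair_eq_pair] at h <;> try omega
    rw [h.2.1, ih h.2.2]

/-- An injective numbering of formulas. -/
noncomputable def Fml.code {D : Type u} [Encodable D] : Fml D → ℕ
  | pred n P args =>
    Nat.pair 0 (Encodable.encode (⟨n, P, args⟩ : Σ n : ℕ, ℕ × (Fin n → ℕ ⊕ D)))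
  | bot => Nat.pair 1 0
  | imp φ ψ => Nat.pair 2 (Nat.pair φ.code ψ.code)
  | all x φ => Nat.pair 3 (Nat.pair x φ.code)
  | box t X φ =>
    Nat.pair 4 (Nat.pair t.code (Nat.pair (Encodable.encode (X : Finset (ℕ ⊕ D))) φ.code))

theorem Fml.code_injective {D : Type u} [Encodable D] :
    Function.Injective (Fml.code : Fml D → ℕ) := by
  intro φ
  induction φ with
  | pred n P args =>
    intro ψ h
    cases ψ <;> simp only [code, Nat.pair_eq_pair] at h <;> try omega
    have h1 := Encodable.encode_injective h.2
    cases h1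
    rfl
  | bot => intro ψ h; cases ψ <;> simp_all [code, Nat.pair_eq_pair]
  | imp φ ψ ih1 ih2 =>
    intro χ h
    cases χ <;> simp only [code, Nat.pair_eq_pair] at h <;> try omega
    rw [ih1 h.2.1, ih2 h.2.2]
  | all x φ ih =>
    intro χ h
    cases χ <;> simp only [code, Nat.pair_eq_pair] at h <;> try omega
    rw [h.2.1, ih h.2.2]
  | box t X φ ih =>
    intro χ h
    cases χ <;> simp only [code, Nat.pair_eq_pair] at h <;> try omega
    rw [JTerm.code_injective h.2.1, Encodable.encode_injective h.2.2.1, ih h.2.2.2]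

instance Fml.instCountable {D : Type u} [Countable D] : Countable (Fml D) :=
  letI := Encodable.ofCountable D
  Fml.code_injective.countable

/-- An injective numbering of templates. -/
def Template.code : Template → ℕ
  | letter i => Nat.pair 0 i
  | neg F => Nat.pair 1 F.code
  | or F G => Nat.pair 2 (Nat.pair F.code G.code)
  | and F G => Nat.pair 3 (Nat.pair F.code G.code)
  | box F => Nat.pair 4 F.code

theorem Template.code_injective : Function.Injective Template.code := by
  intro F
  induction F with
  | letter i => intro H h; cases H <;> simp_all [code, Nat.pair_eq_pair]
  | neg F ih =>
    intro H h
    cases H <;> simp only [code, Nat.pair_eq_pair] at h <;> try omega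
    rw [ih h.2]
  | or F G ih1 ih2 =>
    intro H h
    cases H <;> simp only [code, Nat.pair_eq_pair] at h <;> try omega
    rw [ih1 h.2.1, ih2 h.2.2]
  | and F G ih1 ih2 =>
    intro H h
    cases H <;> simp only [code, Nat.pair_eq_pair] at h <;> try omega
    rw [ih1 h.2.1, ih2 h.2.2]
  | box F ih =>
    intro H h
    cases H <;> simp only [code, Nat.pair_eq_pair] at h <;> try omega
    rw [ih h.2]

instance Template.instCountable : Countable Template := Template.code_injective.countable

/-! ### Building worlds -/

open Template

theorem Template.exists_letters_lt (F : Template) : ∃ k, ∀ i ∈ letters F, i < k :=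
  ⟨(letters F).toFinset.sup id + 1, fun _ hi =>
    Nat.lt_succ_of_le (Finset.le_sup (f := id) (List.mem_toFinset.2 hi))⟩

section Worlds

/-- Every instance of the template `F` under `f` implies an instance of `G` under `g`. -/
def Refines (CS : Set (Fml D)) (f : ℕ → Fml D) (F : Template) (g : ℕ → Fml D) (G : Template) :
    Prop :=
  ∀ ψ ∈ inst f F, ∃ ψ' ∈ inst g G, Derives CS ∅ (imp ψ ψ')

theorem Refines.refl {CS : Set (Fml D)} {f : ℕ → Fml D} (hf : ∀ i, IsDFormula (f i))
    (F : Template) : Refines CS f F f F :=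
  fun ψ hψ => ⟨ψ, hψ, .imp_self (isDFormula_of_mem_inst hf ψ hψ)⟩

theorem Refines.trans {CS : Set (Fml D)} {f g h : ℕ → Fml D} {F G H : Template}
    (hf : ∀ i, IsDFormula (f i)) (hg : ∀ i, IsDFormula (g i)) (hh : ∀ i, IsDFormula (h i))
    (h1 : Refines CS f F g G) (h2 : Refines CS g G h H) : Refines CS f F h H := by
  intro ψ hψ
  obtain ⟨θ, hθ, h3⟩ := h1 ψ hψ
  obtain ⟨χ, hχ, h4⟩ := h2 θ hθ
  exact ⟨χ, hχ, .imp_trans (isDFormula_of_mem_inst hf ψ hψ) (isDFormula_of_mem_inst hg θ hθ)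
    (isDFormula_of_mem_inst hh χ hχ) h3 h4⟩

/-- The disjunctive templates, with formulas assigned to their letters, none of whose instances is
derivable from `S`. -/
def UnprovedTemplate (CS S : Set (Fml D)) : Type u :=
  {s : Template × (ℕ → Fml D) // s.1.IsDisjunctive ∧ (∀ i, IsDFormula (s.2 i)) ∧
    ∀ ψ ∈ inst s.2 s.1, ¬ Derives CS S ψ}

/-- One step of the Henkin construction. Admission of instantiation for the disjunction of the
current template with `F` supplies the witness `a`, and both disjuncts refine to the disjunction. If
the requirements on `F` fail, the template is left unchanged. -/
theorem exists_refinement {CS S : Set (Fml D)} (hCS : IsConstantSpecification CS)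
    (happ : AxiomaticallyAppropriate CS) (hS : ∀ φ ∈ S, IsDFormula φ)
    (hai : AdmitsInstantiation CS S) (s : UnprovedTemplate CS S) (F : Template) (q : ℕ)
    (f : ℕ → Fml D) (x : ℕ) (φ : Fml D) :
    ∃ s' : UnprovedTemplate CS S, Refines CS s.1.2 s.1.1 s'.1.2 s'.1.1 ∧
      (F.IsDisjunctive → (∀ i, IsDFormula (f i)) → IsDFormula φ →
        (∀ ψ ∈ inst s.1.2 s.1.1, ∀ θ ∈ inst (Function.update f q (all x φ)) F,
          ¬ Derives CS S (Fml.or ψ θ)) →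
        ∃ a : D, Refines CS (Function.update f q (subst1 x (Sum.inr a) φ)) F s'.1.2 s'.1.1) := by
  obtain ⟨⟨G, g⟩, hG, hg, hGS⟩ := s
  dsimp only at hG hg hGS ⊢
  by_cases hyp : F.IsDisjunctive ∧ (∀ i, IsDFormula (f i)) ∧ IsDFormula φ ∧
      (∀ ψ ∈ inst g G, ∀ θ ∈ inst (Function.update f q (all x φ)) F,
          ¬ Derives CS S (Fml.or ψ θ))
  · obtain ⟨hF, hf, hφ, hno⟩ := hyp
    obtain ⟨k, hk⟩ := exists_letters_lt G
    -- The letters of `F` are moved above those of `G`: this keeps the disjunction linear and lets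
    -- one assignment serve both parts.
    let f' : ℕ → Fml D := fun i => if i < k then g i else f (i - k)
    have hf' : ∀ i, IsDFormula (f' i) := fun i => by
      dsimp only [f']
      split_ifs
      · exact hg i
      · exact hf _
    have hdisj : (Template.or G (shift k F)).IsDisjunctive := by
      refine ⟨?_, hG.2, onlyOr_shift k hF.2⟩
      refine List.Nodup.append hG.1 ?_ ?_
      · rw [letters_shift]
        exact List.Nodup.map (add_left_injective k) hF.1
      · intro i hi hi'
        rw [letters_shift, List.mem_map] at hi'
        obtain ⟨j, _, rfl⟩ := hi'
        have := hk _ hi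
        omega
    have hinst : ∀ χ : Fml D, inst (Function.update f' (q + k) χ) G = inst g G ∧
        inst (Function.update f' (q + k) χ) (shift k F) = inst (Function.update f q χ) F := by
      intro χ
      constructor
      · refine inst_congr fun i hi => ?_
        have hi := hk i hi
        rw [Function.update_of_ne (by omega)]
        exact if_pos hi
      · rw [inst_shift]
        congr 1
        funext i
        by_cases hi : i = q
        · simp [hi]
        · rw [Function.update_of_ne hi, Function.update_of_ne (by omega)]
          simp [f']
    obtain ⟨a, ha⟩ := hai _ (q + k) f' x φ hdisj hf' hφ (by
      rw [consistent_union_neg_inst_iff hCS happ (isDFormula_update hf' _ (χ := all x φ) hφ)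
        hdisj.2 hS]
      rintro _ ⟨ψ, hψ, θ, hθ, rfl⟩
      rw [(hinst _).1] at hψ
      rw [(hinst _).2] at hθ
      exact hno ψ hψ θ hθ)
    have hD := isDFormula_subst1 hφ x a
    have hD' := isDFormula_update hf' (q + k) hD
    rw [consistent_union_neg_inst_iff hCS happ hD' hdisj.2 hS] at ha
    have hmem : ∀ ψ ∈ inst g G,
        ∀ θ ∈ inst (Function.update f q (subst1 x (Sum.inr a) φ)) F, Fml.or ψ θ ∈
          inst (Function.update f' (q + k) (subst1 x (Sum.inr a) φ))
            (Template.or G (shift k F)) := fun ψ hψ θ hθ =>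
      ⟨ψ, (hinst _).1.symm ▸ hψ, θ, (hinst _).2.symm ▸ hθ, rfl⟩
    have dG := isDFormula_of_mem_inst hg (F := G)
    have dF := isDFormula_of_mem_inst (isDFormula_update hf q hD) (F := F)
    refine ⟨⟨⟨_, _⟩, hdisj, hD', ha⟩, ?_, fun _ _ _ _ => ⟨a, ?_⟩⟩
    · intro ψ hψ
      obtain ⟨θ, hθ⟩ := inst_nonempty (Function.update f q (subst1 x (Sum.inr a) φ)) F
      exact ⟨_, hmem ψ hψ θ hθ, .or_inl hCS.isDFormula (dG ψ hψ) (dF θ hθ)⟩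
    · intro θ hθ
      obtain ⟨ψ, hψ⟩ := inst_nonempty g G
      exact ⟨_, hmem ψ hψ θ hθ, .or_inr (dG ψ hψ) (dF θ hθ)⟩
  · exact ⟨⟨⟨G, g⟩, hG, hg, hGS⟩, .refl hg G,
      fun h1 h2 h3 h4 => absurd ⟨h1, h2, h3, h4⟩ hyp⟩

/-- A set that admits instantiation and does not prove `χ` extends to a maximally consistent set
that admits instantiation and contains `¬χ`. -/
theorem exists_world [Countable D] {CS S : Set (Fml D)} (hCS : IsConstantSpecification CS)
    (happ : AxiomaticallyAppropriate CS) (hS : ∀ φ ∈ S, IsDFormula φ)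
    (hai : AdmitsInstantiation CS S) {χ : Fml D} (hχ : IsDFormula χ) (hno : ¬ Derives CS S χ) :
    ∃ Δ, S ⊆ Δ ∧ neg χ ∈ Δ ∧ MaxConsistent CS Δ ∧ AdmitsInstantiation CS Δ := by
  have hA := hCS.isDFormula
  have : Nonempty (Template × ℕ × List (Fml D) × ℕ × Fml D) := ⟨.letter 0, 0, [], 0, bot⟩
  obtain ⟨e, he⟩ := exists_surjective_nat (Template × ℕ × List (Fml D) × ℕ × Fml D)
  -- Assignments to all letters cannot be enumerated, but a template has finitely many letters, so
  -- finite lists padded with `⊥` suffice.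
  let f : ℕ → ℕ → Fml D := fun n i => (e n).2.2.1.getD i bot
  choose next hnext using fun (n : ℕ) (s : UnprovedTemplate CS S) =>
    exists_refinement hCS happ hS hai s (e n).1 (e n).2.1 (f n) (e n).2.2.2.1 (e n).2.2.2.2
  let s₀ : UnprovedTemplate CS S := ⟨⟨.letter 0, fun _ => χ⟩,
    ⟨List.nodup_singleton 0, trivial⟩, fun _ => hχ, by rintro ψ rfl; exact hno⟩
  let s : ℕ → UnprovedTemplate CS S := fun n => Nat.rec s₀ next n
  have hs : ∀ n, s (n + 1) = next n (s n) := fun n => rfl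
  let I : ℕ → Set (Fml D) := fun n => inst (s n).1.2 (s n).1.1
  have hID : ∀ n, ∀ ψ ∈ I n, IsDFormula ψ := fun n => isDFormula_of_mem_inst (s n).2.2.1
  have hmono : ∀ n m, n ≤ m → Refines CS (s n).1.2 (s n).1.1 (s m).1.2 (s m).1.1 := by
    intro n m hnm
    induction m, hnm using Nat.le_induction with
    | base => exact .refl (s n).2.2.1 _
    | succ m _ ih =>
      refine ih.trans (s n).2.2.1 (s m).2.2.1 (s (m + 1)).2.2.1 ?_
      rw [hs]
      exact (hnext m (s m)).1
  let Δ₀ : Set (Fml D) := S ∪ ⋃ n, inst (s n).1.2 (neg (s n).1.1)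
  have hΔ₀ : ∀ φ ∈ Δ₀, IsDFormula φ := by
    rintro φ (h | h)
    · exact hS φ h
    · obtain ⟨n, ψ, hψ, rfl⟩ := Set.mem_iUnion.1 h
      exact ⟨hID n ψ hψ, trivial⟩
  have hcons : Consistent CS Δ₀ := by
    intro hb
    obtain ⟨Γ, hΓ, hfin, hd⟩ := hb.exists_finite
    -- A negated instance of one stage follows from a negated instance at any later stage, so a
    -- finite set of them is absorbed by a single stage.
    have hev : ∀ φ ∈ Γ, ∀ᶠ m in Filter.atTop,
        Derives CS (S ∪ inst (s m).1.2 (neg (s m).1.1)) φ := by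
      intro φ hφ
      rcases hΓ hφ with h | h
      · exact .of_forall fun m => .hyp (Or.inl h)
      · obtain ⟨n, ψ, hψ, rfl⟩ := Set.mem_iUnion.1 h
        filter_upwards [Filter.eventually_ge_atTop n] with m hm
        obtain ⟨ψ', hψ', h1⟩ := hmono n m hm ψ hψ
        exact .imp_trans (hID n ψ hψ) (hID m ψ' hψ') (show IsDFormula bot from trivial)
          h1.of_empty (.hyp (Or.inr ⟨ψ', hψ', rfl⟩))
    obtain ⟨m, hm⟩ := ((Filter.eventually_all_finite hfin).2 hev).exists
    exact (consistent_union_neg_inst_iff hCS happ (s m).2.2.1 (s m).2.1.2 hS).2 (s m).2.2.2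
      (hd.cut hA (fun φ hφ => hΔ₀ φ (hΓ hφ)) hm)
  obtain ⟨Δ, hsub, hmax⟩ := MaxConsistent.exists_superset hΔ₀ hcons
  have hSΔ : S ⊆ Δ := Set.subset_union_left.trans hsub
  have hIΔ : ∀ n, ∀ ψ ∈ I n, Fml.neg ψ ∈ Δ := fun n ψ hψ =>
    hsub (Or.inr (Set.mem_iUnion.2 ⟨n, ψ, hψ, rfl⟩))
  refine ⟨Δ, hSΔ, hIΔ 0 χ rfl, hmax, ?_⟩
  intro F q g x φ hF hg hφ hc
  rw [consistent_union_neg_inst_iff hCS happ (isDFormula_update hg q (χ := all x φ) hφ) hF.2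
    hmax.1] at hc
  obtain ⟨k, hk⟩ := exists_letters_lt F
  obtain ⟨n, hn⟩ := he (F, q, (List.range k).map g, x, φ)
  have h1 := (hnext n (s n)).2
  have hfn : ∀ i, f n i = ((List.range k).map g).getD i bot := fun i => by
    simp only [f, hn]
  have hfg : ∀ i < k, f n i = g i := fun i hi => by simp [hfn, hi]
  have hfD : ∀ i, IsDFormula (f n i) := fun i => by
    by_cases hi : i < k
    · rw [hfg i hi]; exact hg i
    · rw [hfn, List.getD_eq_default _ _ (by simpa using hi)]; trivial
  have hinst : ∀ ξ, inst (Function.update (f n) q ξ) F = inst (Function.update g q ξ) F :=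
    fun ξ => inst_congr fun i hi => by
      by_cases hiq : i = q
      · simp [hiq]
      · rw [Function.update_of_ne hiq, Function.update_of_ne hiq, hfg i (hk i hi)]
  rw [hn] at h1
  simp only [hinst] at h1
  -- If `S` proved `ψ ∨ θ` with `ψ` an instance of the stage `n` template, then `¬ψ ∈ Δ` would make
  -- `Δ` prove `θ`, contrary to `hc`. So stage `n` did add `F` with a witness.
  obtain ⟨a, ha⟩ := h1 hF hfD hφ fun ψ hψ θ hθ hd =>
    hc θ hθ (.mp (hd.weaken hSΔ) (.hyp (hIΔ n ψ hψ)))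
  refine ⟨a, ?_⟩
  have hgD := isDFormula_update hg q (isDFormula_subst1 hφ x a)
  rw [consistent_union_neg_inst_iff hCS happ hgD hF.2 hmax.1]
  intro ψ hψ hd
  obtain ⟨ψ', hψ', h2⟩ : ∃ ψ' ∈ I (n + 1), Derives CS ∅ (imp ψ ψ') := by
    obtain ⟨ψ', hψ', h2⟩ := ha ψ ((hinst _).symm ▸ hψ)
    exact ⟨ψ', hψ', h2⟩
  exact hmax.2.1 (.mp (.hyp (hIΔ (n + 1) ψ' hψ')) (.mp h2.of_empty hd))

end Worlds

/-! ### Truth in the canonical model -/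

section Truth

variable {V : Type u} [DecidableEq V]

/-- An instantiation sends no symbol to a basic variable other than itself, so it creates no free
basic variables. -/
theorem Fml.IsInstantiation.inl_mem_fv_subst {φ : Fml V} {n : ℕ} :
    ∀ {σ : Var V → Var V}, IsInstantiation σ → Sum.inl n ∈ fv (subst σ φ) →
      Sum.inl n ∈ fv φ ∧ σ (Sum.inl n) = Sum.inl n := by
  have key : ∀ {σ : Var V → Var V}, IsInstantiation σ → ∀ v, σ v = Sum.inl n →
      v = Sum.inl n := by
    intro σ h v hv
    rcases h.eq_self_or v with h1 | ⟨d, h1⟩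
    · rw [← h1, hv]
    · rw [hv] at h1; cases h1
  induction φ with
  | pred m P args =>
    intro σ h hn
    simp only [subst, fv, Finset.mem_image, Finset.mem_univ, true_and] at hn ⊢
    obtain ⟨i, hi⟩ := hn
    have := key h _ hi
    exact ⟨⟨i, this⟩, this ▸ hi⟩
  | bot => intro σ h hn; simp [subst, fv] at hn
  | imp φ ψ ih1 ih2 =>
    intro σ h hn
    simp only [subst, fv, Finset.mem_union] at hn ⊢
    rcases hn with hn | hn
    · exact ⟨Or.inl (ih1 h hn).1, (ih1 h hn).2⟩
    · exact ⟨Or.inr (ih2 h hn).1, (ih2 h hn).2⟩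
  | all x φ ih =>
    intro σ h hn
    simp only [subst, fv, Finset.mem_erase] at hn ⊢
    obtain ⟨h1, h2⟩ := ih (h.update x) hn.2
    rw [Function.update_of_ne hn.1] at h2
    exact ⟨⟨hn.1, h1⟩, h2⟩
  | box t X φ ih =>
    intro σ h hn
    simp only [subst, fv, Finset.mem_image] at hn ⊢
    obtain ⟨v, hv, h1⟩ := hn
    obtain rfl := key h v h1
    exact ⟨hv, h1⟩

theorem Fml.IsInstantiation.sumElim {V : Type u} (a : ℕ → V) :
    IsInstantiation (Sum.elim (fun x => Sum.inr (a x)) Sum.inr : Var V → Var V) :=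
  ⟨fun _ => rfl, fun n => Or.inr ⟨a n, rfl⟩⟩

theorem Fml.isClosed_instAll (a : ℕ → V) (φ : Fml V) : IsClosed (instAll a φ) := fun n hn => by
  have := ((IsInstantiation.sumElim a).inl_mem_fv_subst hn).2
  cases this

theorem Fml.IsClosed.subst1 {x : ℕ} {φ : Fml V} (h : IsClosed (all x φ)) (a : V) :
    IsClosed (subst1 x (Sum.inr a) φ) := fun n hn => by
  obtain ⟨h1, h2⟩ := (IsInstantiation.single x a).inl_mem_fv_subst hn
  by_cases hnx : n = x
  · subst hnx
    simp [Fml.single] at h2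
  · exact h n (Finset.mem_erase.2 ⟨by simpa using hnx, h1⟩)

theorem Fml.IsClosed.instAll_eq {φ : Fml V} (h : IsClosed φ) (a : ℕ → V) : instAll a φ = φ := by
  refine subst_eq_self fun v hv => ?_
  cases v with
  | inl n => exact absurd hv (h n)
  | inr d => rfl

/-- The set of formulas that is the world `w`. -/
def CanonicalWorld.toSet {CS : Set (Fml V)} (w : CanonicalWorld CS) : Set (Fml V) :=
  Subtype.val (p := fun Γ => MaxConsistent (extendCS CS) Γ ∧ AdmitsInstantiation (extendCS CS) Γ) w

theorem CanonicalWorld.maxConsistent {CS : Set (Fml V)} (hCS : IsConstantSpecification CS)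
    (w : CanonicalWorld CS) : MaxConsistent CS w.toSet :=
  hCS.maxConsistent_extendCS_iff.1 (Subtype.prop w).1

theorem CanonicalWorld.admitsInstantiation {CS : Set (Fml V)} (hCS : IsConstantSpecification CS)
    (w : CanonicalWorld CS) : AdmitsInstantiation CS w.toSet :=
  (hCS.admitsInstantiation_extendCS_iff (w.maxConsistent hCS).1).1 (Subtype.prop w).2

/-- A universal formula belongs to a world as soon as its instances by witness variables do. -/
theorem CanonicalWorld.all_mem_iff {CS : Set (Fml V)} (hCS : IsConstantSpecification CS)
    (w : CanonicalWorld CS) {x : ℕ} {φ : Fml V} (hφ : IsDFormula φ) :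
    all x φ ∈ w.toSet ↔ ∀ a : V, subst1 x (Sum.inr a) φ ∈ w.toSet := by
  have hA := hCS.isDFormula
  have hmax := w.maxConsistent hCS
  refine ⟨fun h a => hmax.mem_of_derives hA (.subst1_const hφ a (.hyp h)), fun h => ?_⟩
  by_contra hn
  rw [hmax.not_mem_iff_neg_mem hA (φ := all x φ) hφ] at hn
  -- For the one-letter template, the only negated instance is `¬∀ x φ`, which already belongs to
  -- the world.
  obtain ⟨a, ha⟩ := w.admitsInstantiation hCS (.letter 0) 0 (fun _ => bot) x φ
    ⟨List.nodup_singleton 0, trivial⟩ (fun _ => trivial) hφ (by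
      rw [Set.union_eq_left.2]
      · exact hmax.2.1
      · rintro _ ⟨_, rfl, rfl⟩
        simpa using hn)
  refine ha (.mp (φ := subst1 x (Sum.inr a) φ) (.hyp (Or.inr ⟨_, rfl, ?_⟩)) (.hyp (Or.inl (h a))))
  simp [Fml.neg]

/-- The induction is on the degree, which substitution preserves. For a box, truth gives membership
through the evidence function alone; conversely, membership puts the universal closure of the body
into every accessible world, where it is instantiated. -/
theorem truth_iff_mem {CS : Set (Fml V)} (hCS : IsConstantSpecification CS) {φ : Fml V}
    (hφ : IsDFormula φ) (hcl : IsClosed φ) (w : CanonicalWorld CS) :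
    (canonicalModel CS).Truth w φ ↔ φ ∈ w.toSet := by
  have hA := hCS.isDFormula
  induction hn : degree φ using Nat.strong_induction_on generalizing φ w with
  | _ n ih =>
    have hmax := w.maxConsistent hCS
    subst hn
    cases φ with
    | pred n P args =>
      rw [FittingModel.Truth]
      constructor
      · rintro ⟨a, ha, hmem⟩
        rwa [funext ha]
      · intro h
        have : ∀ i, ∃ a : V, args i = Sum.inr a := fun i => by
          cases hi : args i with
          | inl m => exact absurd (Finset.mem_image.2 ⟨i, Finset.mem_univ _, hi⟩) (hcl m)
          | inr a => exact ⟨a, rfl⟩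
        choose a ha using this
        exact ⟨a, ha, by rwa [funext ha] at h⟩
    | bot =>
      rw [FittingModel.Truth]
      exact ⟨False.elim, fun h => hmax.2.1 (.hyp h)⟩
    | imp φ ψ =>
      rw [FittingModel.Truth, hmax.imp_mem_iff hA hφ.1 hφ.2]
      have h1 : IsClosed φ := fun x hx => hcl x (Finset.mem_union_left _ hx)
      have h2 : IsClosed ψ := fun x hx => hcl x (Finset.mem_union_right _ hx)
      exact imp_congr (ih _ (by simp only [degree]; omega) hφ.1 h1 w rfl)
        (ih _ (by simp only [degree]; omega) hφ.2 h2 w rfl)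
    | all x φ =>
      rw [FittingModel.Truth]
      refine Iff.trans (forall_congr' fun a => ?_) (w.all_mem_iff hCS (φ := φ) hφ).symm
      exact ih (degree φ) (by rw [degree]; omega) (φ := subst1 x (Sum.inr a) φ)
        (isDFormula_subst1 (φ := φ) hφ x a) (hcl.subst1 a) w (degree_subst φ _)
    | box t X φ =>
      rw [FittingModel.Truth]
      constructor
      · rintro ⟨⟨_, h⟩, _⟩
        exact hmax.mem_of_derives hA
          ((Derives.hyp h).box_enlarge hφ.1 hφ.2 (Finset.Subset.refl _))
      · intro h
        -- Closedness makes `X` a set of constants, and those not occurring in `φ` can be dropped.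
        have h1 : box t (consts φ) φ ∈ w.toSet := by
          refine hmax.mem_of_derives hA ((Derives.hyp h).box_shrink hφ.1 hφ.2
            (Finset.Subset.refl _) fun v hv hvf => ?_)
          cases v with
          | inl n => exact absurd hv (hcl n)
          | inr d => exact inr_mem_consts_of_mem_fv hvf
        refine ⟨⟨hφ.2, h1⟩, fun w' hw' a => ?_⟩
        refine (ih (degree φ) (by rw [degree]; omega) (φ := instAll a φ)
          (IsInstantiation.isDFormula_subst hφ.2 (.sumElim a)) (isClosed_instAll a φ) w'
          (degree_subst φ _)).2 ?_
        obtain ⟨ys, hnd, hys, hmem⟩ := exists_alls_mem_sharp hφ.2 h1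
        exact (w'.maxConsistent hCS).mem_of_derives hA
          (Derives.instAll hnd hys hφ.2 a (.hyp (hw' hmem)))

theorem canonicalModel_fullyExplanatory [Countable V] {CS : Set (Fml V)}
    (hCS : IsConstantSpecification CS) (happ : AxiomaticallyAppropriate CS) :
    (canonicalModel CS).FullyExplanatory := by
  intro φ hφ hcl w hall
  by_cases hd : Derives CS (sharp w.toSet) φ
  · obtain ⟨t, ht⟩ := justified_of_derives_sharp hCS happ hd
    refine ⟨t, ?_⟩
    rw [FittingModel.Truth]
    refine ⟨⟨hφ, (w.maxConsistent hCS).mem_of_derives hCS.isDFormula ht⟩, fun w' hw' a => ?_⟩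
    rw [hcl.instAll_eq]
    exact hall w' hw'
  · exfalso
    -- Containing `Γ^#` is accessibility, so this is an accessible world with `¬φ`.
    obtain ⟨Δ, hsub, hneg, hmax, hai⟩ := exists_world hCS happ (isDFormula_sharp w.toSet)
      (admitsInstantiation_sharp hCS happ (w.maxConsistent hCS) (w.admitsInstantiation hCS)) hφ hd
    let v : CanonicalWorld CS := ⟨Δ, hCS.maxConsistent_extendCS_iff.2 hmax,
      (hCS.admitsInstantiation_extendCS_iff hmax.1).2 hai⟩
    have h1 := (truth_iff_mem hCS hφ hcl v).1 (hall v hsub)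
    exact hmax.2.1 (.mp (.hyp hneg) (.hyp h1))

end Truth

end FOLPb

/-- The canonical model of `FOLPb` is fully explanatory.  Variant closedness of `CS` is not used: an
axiom with witness variables is justified by taking a constant for a basic axiom with fresh basic
variables in their place, then enlarging the subscript, generalizing and instantiating. -/
theorem mainTheorem3 {V : Type*} [DecidableEq V] [Countable V] [Infinite V]
    (CS : Set (FOLPb.Fml V)) (hCS : FOLPb.IsConstantSpecification CS)
    (hvar : FOLPb.VariantClosed CS) (happ : FOLPb.AxiomaticallyAppropriate CS) :
    (FOLPb.canonicalModel CS).FullyExplanatory :=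
  FOLPb.canonicalModel_fullyExplanatory hCS happ
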